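/- Let $1\le L\le N$ be integers, let $\mathcal P_s\subseteq\{0,\dots,N-1\}$ be a non-empty set of $s$ subcarriers, and let $D>0$, $\Delta>0$, $\theta_1,\theta_2\in\mathbb R$, $\rho_{\rm B},\rho_{\rm A}>0$ and phases $\phi_0,\phi_1,\varphi_0,\varphi_1\in\mathbb R$ be given. Put ${\bf x}_{1}=\sqrt{\rho_{\rm B}}\,[e^{j\phi_0},e^{j\phi_1}]^{\rm T}$ (Bob's pilots at two symbol times), ${\bf x}_{2}=\sqrt{\rho_{\rm A}}\,[e^{j\varphi_0},e^{j\varphi_1}]^{\rm T}$ (Ava's pilots) and ${\bf X}=[{\bf x}_1\ {\bf x}_2]$, and assume that ${\bf X}$ is invertible or $\rho_{\rm B}=\rho_{\rm A}$. Let ${\bf F}$ be the unitary $N\times N$ DFT matrix, ${\bf F}_{s}$ its rows indexed by $\mathcal P_s$, ${\bf F}_{{\rm L},s}$ the rows indexed by $\mathcal P_s$ of $\sqrt N\,{\bf F}(:,1{:}L)$, and ${\bf R}_{\rm F}={\bf F}_{{\rm L},s}^{\rm T}{\bf F}_{{\rm L},s}^{*}$. For a number $N_{\rm T}$ of antennas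 and a noise power $\sigma^2>0$, let ${\bf h}_{\rm B}^i,{\bf h}_{\rm A}^i\in\mathbb C^{L}$ ($1\le i\le N_{\rm T}$) be the random channel impulse responses of Bob and Ava: the $L$ taps are independent and each tap is, across the antennas, a circularly symmetric complex Gaussian vector with covariance matrix ${\bf R}_1$ (Bob) or ${\bf R}_2$ (Ava), where $[{\bf R}_k]_{m,n}=\frac1{2\Delta L}\int_{\theta_k-\Delta}^{\theta_k+\Delta}e^{-j2\pi D(m-n)\sin\theta}\,d\theta$. Let the time-domain noise vectors ${\bf v}^i[k]\sim\mathcal{CN}(0,\sigma^2{\bf I}_N)$ be independent over the antennas $i$ and the two symbol times $k$, and let Bob's channels, Ava's channels and the noise be independent. Let ${\bf h}_{\rm B,L}$ and ${\bf h}_{\rm A,L}$ be the $1\times N_{\rm T}s$ rows obtained by concatenating $({\bf F}_{{\rm L},s}{\bf h}^i_{\rm B})^{\rm T}$, respectively $({\bf F}_{{\rm L},s}{\bf h}^i_{\rm A})^{\rm T}$, over $i$; let ${\bf N}$ be the $2\times N_{\rm T}s$ matrix whose rows concatenate $({\bf F}_s{\bf v}^i[k])^{\rm T}$ over $i$; and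 let ${\bf Y}={\bf x}_1{\bf h}_{\rm B,L}+{\bf x}_2{\bf h}_{\rm A,L}+{\bf N}$. With ${\bf C}=\frac1{N_{\rm T}s}{\bf Y}{\bf Y}^{\rm H}$, $T_{\rm B}=\frac{{\rm Tr}({\bf R}_1){\rm Tr}({\bf R}_{\rm F})}{N_{\rm T}s}$ and $T_{\rm A}=\frac{{\rm Tr}({\bf R}_2){\rm Tr}({\bf R}_{\rm F})}{N_{\rm T}s}$, the asymptotically optimal LMMSE estimates are $\widehat{\bf h}_{\rm B,L}=T_{\rm B}{\bf x}_1^{\rm H}{\bf C}^{-1}{\bf Y}$ and $\widehat{\bf h}_{\rm A,L}=T_{\rm A}{\bf x}_2^{\rm H}{\bf C}^{-1}{\bf Y}$, and their normalised mean square errors are $\varepsilon_{\rm B}^2=\frac{\mathbb E\|\widehat{\bf h}_{\rm B,L}-{\bf h}_{\rm B,L}\|^2}{N_{\rm T}s}$ and $\varepsilon_{\rm A}^2=\frac{\mathbb E\|\widehat{\bf h}_{\rm A,L}-{\bf h}_{\rm A,L}\|^2}{N_{\rm T}s}$. Then, for each $\sigma^2>0$, both errors are finite for all large $N_{\rm T}$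 and converge as $N_{\rm T}\to\infty$; and as $\sigma^2\to0^+$ these two large-array limits converge to a common value: $$\lim_{\sigma^2\to0^+}\lim_{N_{\rm T}\to\infty}\varepsilon_{\rm B}^2=\lim_{\sigma^2\to0^+}\lim_{N_{\rm T}\to\infty}\varepsilon_{\rm A}^2 .$$ -/

import Mathlib

open MeasureTheory ProbabilityTheory Filter Topology
open scoped NNReal Matrix Kronecker

namespace PilotTraining

noncomputable section

/-- The circularly symmetric complex Gaussian law `CN(0, v)` on `ℂ`: the real and imaginary parts
are independent centred real Gaussians of variance `v / 2` each. -/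
def complexGaussian (v : ℝ≥0) : Measure ℂ :=
  ((gaussianReal 0 (v / 2)).prod (gaussianReal 0 (v / 2))).map
    (fun p : ℝ × ℝ => (p.1 : ℂ) + (p.2 : ℂ) * Complex.I)

/-- The finite random vector `h` has law `CN(0, Γ)`: each linear combination `∑ aᵢ hᵢ` has the
circularly symmetric Gaussian law whose variance is `∑ aᵢ Γᵢⱼ conj aⱼ`
(so that `E[hᵢ conj hⱼ] = Γᵢⱼ`). -/
def IsCircularGaussian {Ω ι : Type*} [MeasurableSpace Ω] [Fintype ι] (μ : Measure Ω)
    (h : ι → Ω → ℂ) (Γ : Matrix ι ι ℂ) : Prop :=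
  ∀ a : ι → ℂ, ∃ v : ℝ≥0,
    (((v : ℝ) : ℂ) = ∑ i, ∑ j, a i * Γ i j * star (a j)) ∧
      HasLaw (fun ω => ∑ i, a i * h i ω) (complexGaussian v) μ

/-- The deterministic parameters of the two-symbol uplink training with `N` FFT points and `L`
channel taps. Users are indexed by `Fin 2`: user `0` is Bob, user `1` is Ava. The two OFDM symbol
times are also indexed by `Fin 2`. -/
structure Setup (N L : ℕ) where
  /-- the set of overlapping subcarriers -/
  P : Finset (Fin N)
  /-- the antenna spacing, in wavelengths -/
  D : ℝ
  /-- the angular spread -/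
  Δ : ℝ
  /-- the mean angles of arrival of the users -/
  θ : Fin 2 → ℝ
  /-- the training powers of the users -/
  ρ : Fin 2 → ℝ
  /-- `φ u k` is the pilot phase of user `u` at symbol time `k` -/
  φ : Fin 2 → Fin 2 → ℝ

/-- The unitary `N × N` DFT matrix. -/
def dft (N : ℕ) : Matrix (Fin N) (Fin N) ℂ := Matrix.of fun p q =>
  Complex.exp (-(2 * Real.pi * Complex.I * (p : ℕ) * (q : ℕ) / N)) / (Real.sqrt N : ℂ)

namespace Setup

variable {N L : ℕ} (S : Setup N L)

/-- The number `s` of overlapping subcarriers. -/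
def s : ℕ := S.P.card

/-- The pilot matrix `X = [x₁ x₂]`: row = symbol time, column = user,
with entries `√ρ_u e^{jφ_{u,k}}`. -/
def X : Matrix (Fin 2) (Fin 2) ℂ := Matrix.of fun k u =>
  (Real.sqrt (S.ρ u) : ℂ) * Complex.exp (Complex.I * S.φ u k)

/-- The pilot vector of user `u` over the two symbol times. -/
def pilot (u : Fin 2) : Fin 2 → ℂ := fun k => S.X k u

/-- The rows indexed by `P` of the matrix formed by `√N` times the first `L` columns of the
DFT matrix (this needs `L ≤ N`). -/
def FLs (hL : L ≤ N) : Matrix S.P (Fin L) ℂ := Matrix.of fun p l =>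
  (Real.sqrt N : ℂ) * dft N p.1 (Fin.castLE hL l)

/-- The rows indexed by `P` of the DFT matrix. -/
def Fs : Matrix S.P (Fin N) ℂ := Matrix.of fun p q => dft N p.1 q

/-- `R_F = F_{L,s}ᵀ F_{L,s}^*`. -/
def RF (hL : L ≤ N) : Matrix (Fin L) (Fin L) ℂ :=
  (S.FLs hL)ᵀ * (S.FLs hL).map star

/-- The one-ring spatial covariance matrix of user `u` for `NT` antennas; every tap has
the normalised power `1 / L`. -/
def R (NT : ℕ) (u : Fin 2) : Matrix (Fin NT) (Fin NT) ℂ := Matrix.of fun m n =>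
  (1 / (2 * S.Δ * L) : ℂ) *
    ∫ t in (S.θ u - S.Δ)..(S.θ u + S.Δ),
      Complex.exp (-(2 * Real.pi * Complex.I * S.D * (((m : ℕ) : ℂ) - ((n : ℕ) : ℂ)) * Real.sin t))

/-- The constant `T_u = Tr(R_u) Tr(R_F) / (NT s)`. -/
def T (hL : L ≤ N) (NT : ℕ) (u : Fin 2) : ℂ :=
  (S.R NT u).trace * (S.RF hL).trace / ((NT : ℂ) * S.s)

variable {NT : ℕ}

/-- The `2 × NT·s` matrix of frequency-domain channels; row `u` belongs to user `u`, and consists of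
the vectors `F_{L,s} h_u^i` for the antennas `i`. Here `h u (i, l)` is tap `l` of the impulse
response from user `u` to antenna `i`. -/
def H (hL : L ≤ N) (h : Fin 2 → Fin NT × Fin L → ℂ) : Matrix (Fin 2) (Fin NT × S.P) ℂ :=
  Matrix.of fun u ip => (S.FLs hL *ᵥ fun l => h u (ip.1, l)) ip.2

/-- The `2 × NT·s` noise matrix; `w (i, k, q)` is the `q`-th time-domain noise sample
at antenna `i` and symbol time `k`. -/
def noise (w : Fin NT × Fin 2 × Fin N → ℂ) : Matrix (Fin 2) (Fin NT × S.P) ℂ :=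
  Matrix.of fun k ip => (S.Fs *ᵥ fun q => w (ip.1, k, q)) ip.2

/-- The received signal `Y = X H + N`. -/
def Y (hL : L ≤ N) (h : Fin 2 → Fin NT × Fin L → ℂ) (w : Fin NT × Fin 2 × Fin N → ℂ) :
    Matrix (Fin 2) (Fin NT × S.P) ℂ :=
  S.X * S.H hL h + S.noise w

/-- The sample covariance matrix `Y Yᴴ / (NT s)`. -/
def C (hL : L ≤ N) (h : Fin 2 → Fin NT × Fin L → ℂ) (w : Fin NT × Fin 2 × Fin N → ℂ) :
    Matrix (Fin 2) (Fin 2) ℂ :=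
  (1 / ((NT : ℂ) * S.s)) • (S.Y hL h w * (S.Y hL h w)ᴴ)

/-- The asymptotically optimal LMMSE estimator `W_u = T_u x_uᴴ C⁻¹` (a row vector). -/
def W (hL : L ≤ N) (u : Fin 2) (h : Fin 2 → Fin NT × Fin L → ℂ)
    (w : Fin NT × Fin 2 × Fin N → ℂ) : Fin 2 → ℂ :=
  S.T hL NT u • (star (S.pilot u) ᵥ* (S.C hL h w)⁻¹)

/-- The estimate `W_u Y` of the frequency-domain channel of user `u`. -/
def estimate (hL : L ≤ N) (u : Fin 2) (h : Fin 2 → Fin NT × Fin L → ℂ)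
    (w : Fin NT × Fin 2 × Fin N → ℂ) : Fin NT × S.P → ℂ :=
  S.W hL u h w ᵥ* S.Y hL h w

/-- The squared Euclidean norm of the estimation error of user `u`. -/
def sqError (hL : L ≤ N) (u : Fin 2) (h : Fin 2 → Fin NT × Fin L → ℂ)
    (w : Fin NT × Fin 2 × Fin N → ℂ) : ℝ :=
  ∑ ip, ‖S.estimate hL u h w ip - S.H hL h u ip‖ ^ 2

variable {Ω : Type*} [MeasurableSpace Ω]

/-- The random model for `NT` antennas and noise power `σ2`: for each user the taps are
independent, each tap is a circular Gaussian vector over the antennas with covariance `R_u`; the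
noise samples are independent `CN(0, σ2)`; both channels and the noise are independent. -/
structure IsModel (μ : Measure Ω) (NT : ℕ) (σ2 : ℝ) (h : Fin 2 → Fin NT × Fin L → Ω → ℂ)
    (w : Fin NT × Fin 2 × Fin N → Ω → ℂ) : Prop where
  channel : ∀ u, IsCircularGaussian μ (h u) (S.R NT u ⊗ₖ (1 : Matrix (Fin L) (Fin L) ℂ))
  noise : IsCircularGaussian μ w ((σ2 : ℂ) • (1 : Matrix _ _ ℂ))
  indep_channels : IndepFun (fun ω x => h 0 x ω) (fun ω x => h 1 x ω) μ
  indep_noise : IndepFun (fun ω u x => h u x ω) (fun ω x => w x ω) μ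

/-- The normalised mean square error `E‖ĥ_u - h_u‖² / (NT s)`. -/
def nmse (hL : L ≤ N) (μ : Measure Ω) (u : Fin 2) (h : Fin 2 → Fin NT × Fin L → Ω → ℂ)
    (w : Fin NT × Fin 2 × Fin N → Ω → ℂ) : ℝ :=
  (∫ ω, S.sqError hL u (fun v x => h v x ω) (fun x => w x ω) ∂μ) / ((NT : ℝ) * S.s)

end Setup

end

end PilotTraining

/-!
Since `T_B = T_A = 1`, both errors are a fixed function of the `4 × 4` sample Gram matrix of the two
channel rows and the two noise rows. A linear combination of these rows is a Gaussian vector whose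
covariance matrix has Frobenius norm `o(N_T s)`: by Wiener's lemma, because `sin` takes every value
on a null set. So the Gram matrix converges in mean square to `diag(1, 1, σ², σ²)`. The error is
continuous at this limit, and passing to expectations requires uniform integrability, hence a bound
on the second moment of `1 / det C`; this comes from `1 / det C = π⁻² ∫ exp (-zᴴ C z) dz`,
Minkowski's integral inequality and the Laplace transform of a Gaussian vector.

The limit error of user `u` is `1 - x_uᴴ (X Xᴴ + σ² I)⁻¹ x_u`, that is,
`1 - (|det X|² + 2 ρ_u σ²) / (|det X|² + 2 (ρ_B + ρ_A) σ² + σ⁴)`. As `σ² → 0⁺` it tends to `0` if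
`X` is invertible, and to `1 - ρ_u / (ρ_B + ρ_A)` otherwise, which is `1 / 2` when the powers agree.
-/

namespace PilotTraining

open scoped ENNReal

section ComplexGaussian

theorem complexGaussian_eq_map_equiv (v : ℝ≥0) :
    complexGaussian v = ((gaussianReal 0 (v / 2)).prod (gaussianReal 0 (v / 2))).map
      Complex.measurableEquivRealProd.symm :=
  congrArg (Measure.map · _) (funext fun p => (Complex.mk_eq_add_mul_I p.1 p.2).symm)

instance (v : ℝ≥0) : IsProbabilityMeasure (complexGaussian v) :=
  Measure.isProbabilityMeasure_map (by fun_prop)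

theorem complexGaussian_zero : complexGaussian 0 = Measure.dirac 0 := by
  rw [complexGaussian_eq_map_equiv, zero_div, gaussianReal_zero_var, Measure.dirac_prod_dirac,
    Measure.map_dirac' (by fun_prop)]
  rfl

theorem charFun_complexGaussian (v : ℝ≥0) (t : ℂ) :
    charFun (complexGaussian v) t = Complex.exp (-(v * ‖t‖ ^ 2 / 4 : ℝ)) := by
  have hreal (a : ℝ) := charFun_gaussianReal (μ := 0) (v := v / 2) a
  simp only [charFun_apply_real] at hreal
  have hsplit (p : ℝ × ℝ) : Complex.exp
      ((inner ℝ (Complex.measurableEquivRealProd.symm p) t : ℝ) * Complex.I) =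
      Complex.exp (t.re * p.1 * Complex.I) * Complex.exp (t.im * p.2 * Complex.I) := by
    rw [← Complex.exp_add, Complex.inner]
    congr 1
    simp only [Complex.measurableEquivRealProd_symm_apply, Complex.mul_re, Complex.conj_re,
      Complex.conj_im, mul_neg, sub_neg_eq_add, Complex.ofReal_add, Complex.ofReal_mul]
    ring
  rw [charFun_apply, complexGaussian_eq_map_equiv, integral_map_equiv]
  simp_rw [hsplit]
  rw [integral_prod_mul (fun x : ℝ => Complex.exp (t.re * x * Complex.I))
    (fun x : ℝ => Complex.exp (t.im * x * Complex.I)), hreal, hreal, ← Complex.exp_add,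
    ← Complex.normSq_eq_norm_sq, Complex.normSq_apply]
  congr 1
  push_cast
  ring

theorem complexGaussian_conv (v₁ v₂ : ℝ≥0) :
    (complexGaussian v₁) ∗ (complexGaussian v₂) = complexGaussian (v₁ + v₂) := by
  refine Measure.ext_of_charFun (funext fun t => ?_)
  simp_rw [charFun_conv, charFun_complexGaussian, ← Complex.exp_add]
  congr 1
  push_cast
  ring

theorem gaussianPDFReal_mul_gaussianPDFReal (v : ℝ≥0) (x y : ℝ) :
    gaussianPDFReal 0 (v / 2) x * gaussianPDFReal 0 (v / 2) y =
      (Real.pi * v)⁻¹ * Real.exp (-(v : ℝ)⁻¹ * (x ^ 2 + y ^ 2)) := by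
  have hv : 2 * Real.pi * (v / 2 : ℝ) = Real.pi * v := by ring
  simp only [gaussianPDFReal, NNReal.coe_div, NNReal.coe_ofNat, hv, sub_zero]
  rw [mul_mul_mul_comm, ← mul_inv, Real.mul_self_sqrt (by positivity), ← Real.exp_add]
  congr 2
  field_simp
  ring

theorem integral_complexGaussian {v : ℝ≥0} (hv : v ≠ 0) (f : ℂ → ℝ) :
    ∫ z, f z ∂complexGaussian v =
      (Real.pi * v)⁻¹ * ∫ z, f z * Real.exp (-(v : ℝ)⁻¹ * ‖z‖ ^ 2) := by
  have hv2 : v / 2 ≠ 0 := by simpa using hv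
  rw [complexGaussian_eq_map_equiv, integral_map_equiv, gaussianReal_of_var_ne_zero 0 hv2,
    prod_withDensity (by fun_prop) (by fun_prop),
    integral_withDensity_eq_integral_toReal_smul (by fun_prop)
      (ae_of_all _ fun _ => ENNReal.mul_lt_top gaussianPDF_lt_top gaussianPDF_lt_top),
    ← integral_const_mul,
    ← Complex.volume_preserving_equiv_real_prod.symm.integral_comp' (g := fun z =>
      (Real.pi * v)⁻¹ * (f z * Real.exp (-(v : ℝ)⁻¹ * ‖z‖ ^ 2)))]
  refine integral_congr_ae (ae_of_all _ fun p => ?_)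
  simp only [ENNReal.toReal_mul, toReal_gaussianPDF, smul_eq_mul,
    gaussianPDFReal_mul_gaussianPDFReal, ← Complex.normSq_eq_norm_sq, Complex.normSq_apply,
    Complex.measurableEquivRealProd_symm_apply]
  ring_nf

theorem integral_norm_pow_complexGaussian (v : ℝ≥0) (k : ℕ) :
    ∫ z, ‖z‖ ^ (2 * k) ∂complexGaussian v = k.factorial * (v : ℝ) ^ k := by
  rcases eq_or_ne v 0 with rfl | hv
  · rcases k.eq_zero_or_pos with rfl | hk
    · simp
    · simp [complexGaussian_zero, hk.ne']
  · have hv' : (0 : ℝ) < v := by positivity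
    have h := Complex.integral_rpow_mul_exp_neg_mul_rpow one_le_two
      (show (-2 : ℝ) < (2 * k : ℕ) by linarith [(2 * k : ℕ).cast_nonneg (α := ℝ)]) (inv_pos.2 hv')
    have hk : ((2 * k : ℕ) + 2 : ℝ) / 2 = k + 1 := by push_cast; ring
    simp only [Real.rpow_natCast, Real.rpow_two] at h
    rw [integral_complexGaussian hv, h, neg_div, hk, Real.Gamma_nat_eq_factorial,
      Real.inv_rpow hv'.le, Real.rpow_neg hv'.le, inv_inv, ← Nat.cast_succ, Real.rpow_natCast,
      pow_succ]
    field_simp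

theorem integrable_norm_pow_complexGaussian (v : ℝ≥0) (k : ℕ) :
    Integrable (fun z : ℂ => ‖z‖ ^ (2 * k)) (complexGaussian v) := by
  rcases eq_or_ne v 0 with rfl | hv
  · rw [complexGaussian_zero]
    exact integrable_dirac (by simp)
  · refine Integrable.of_integral_ne_zero ?_
    rw [integral_norm_pow_complexGaussian]
    positivity

theorem integral_exp_neg_mul_norm_sq_complexGaussian (v : ℝ≥0) {c : ℝ} (hc : 0 ≤ c) :
    ∫ z, Real.exp (-c * ‖z‖ ^ 2) ∂complexGaussian v = (1 + v * c)⁻¹ := by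
  rcases eq_or_ne v 0 with rfl | hv
  · simp [complexGaussian_zero]
  · have hv' : (0 : ℝ) < v := by positivity
    have h := Complex.integral_exp_neg_mul_rpow one_le_two
      (add_pos_of_nonneg_of_pos hc (inv_pos.2 hv'))
    simp only [Real.rpow_two] at h
    simp_rw [integral_complexGaussian hv, ← Real.exp_add, ← add_mul, ← neg_add]
    rw [h, neg_div, div_self two_ne_zero, Real.rpow_neg_one, one_add_one_eq_two, Real.Gamma_two]
    field_simp
    ring

end ComplexGaussian

section CircularGaussian

variable {Ω : Type*} [MeasurableSpace Ω] {μ : Measure Ω} {ι κ : Type*} [Fintype ι] [Fintype κ]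

theorem sum_sum_mul_mul_star (Γ : Matrix ι ι ℂ) (a : ι → ℂ) :
    ∑ i, ∑ j, a i * Γ i j * star (a j) = (a ᵥ* Γ) ⬝ᵥ star a := by
  simp only [Matrix.vecMul, dotProduct, Finset.sum_mul, Pi.star_apply]
  exact Finset.sum_comm

theorem isCircularGaussian_iff {f : ι → Ω → ℂ} {Γ : Matrix ι ι ℂ} :
    IsCircularGaussian μ f Γ ↔ ∀ a : ι → ℂ, ∃ v : ℝ≥0, ((v : ℝ) : ℂ) = (a ᵥ* Γ) ⬝ᵥ star a ∧
      HasLaw (fun ω => a ⬝ᵥ fun i => f i ω) (complexGaussian v) μ := by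
  simp only [IsCircularGaussian, sum_sum_mul_mul_star, dotProduct]

theorem IsCircularGaussian.mulVec {f : ι → Ω → ℂ} {Γ : Matrix ι ι ℂ}
    (hf : IsCircularGaussian μ f Γ) (A : Matrix κ ι ℂ) :
    IsCircularGaussian μ (fun k ω => (A *ᵥ fun i => f i ω) k) (A * Γ * Aᴴ) := by
  refine isCircularGaussian_iff.2 fun a => ?_
  obtain ⟨v, hv, hl⟩ := isCircularGaussian_iff.1 hf (a ᵥ* A)
  refine ⟨v, ?_, ?_⟩
  · rw [hv, Matrix.star_vecMul, Matrix.dotProduct_mulVec, Matrix.vecMul_vecMul,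
      Matrix.vecMul_vecMul, Matrix.mul_assoc]
  · simpa only [Matrix.dotProduct_mulVec] using hl

theorem IsCircularGaussian.add_of_indepFun {f g : ι → Ω → ℂ}
    {Γ Γ' : Matrix ι ι ℂ} (hf : IsCircularGaussian μ f Γ) (hg : IsCircularGaussian μ g Γ')
    (hfg : IndepFun (fun ω i => f i ω) (fun ω i => g i ω) μ) :
    IsCircularGaussian μ (fun i ω => f i ω + g i ω) (Γ + Γ') := by
  refine isCircularGaussian_iff.2 fun a => ?_
  obtain ⟨v, hv, hl⟩ := isCircularGaussian_iff.1 hf a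
  obtain ⟨v', hv', hl'⟩ := isCircularGaussian_iff.1 hg a
  refine ⟨v + v', by push_cast; rw [hv, hv', Matrix.vecMul_add, add_dotProduct], ?_⟩
  have ha : Measurable fun x : ι → ℂ => a ⬝ᵥ x := by
    unfold dotProduct
    fun_prop
  have hadd := IndepFun.hasLaw_add hl hl' (hfg.comp ha ha)
  rw [complexGaussian_conv] at hadd
  convert! hadd using 2 with ω
  exact dotProduct_add _ _ _

theorem IsCircularGaussian.hasLaw_add_mul {f : ι → Ω → ℂ} {Γ : Matrix ι ι ℂ}
    (hf : IsCircularGaussian μ f Γ) (j k : ι) (c : ℂ) :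
    ∃ v : ℝ≥0, ((v : ℝ) : ℂ) = Γ j j + star c * Γ j k + c * Γ k j + c * star c * Γ k k ∧
      HasLaw (fun ω => f j ω + c * f k ω) (complexGaussian v) μ := by
  classical
  obtain ⟨v, hv, hl⟩ := isCircularGaussian_iff.1 hf (Pi.single j 1 + c • Pi.single k 1)
  refine ⟨v, hv.trans ?_, ?_⟩
  · simp only [star_add, star_smul, Pi.star_single, star_one, Matrix.add_vecMul,
      Matrix.smul_vecMul, Matrix.single_one_vecMul, dotProduct_add, dotProduct_smul,
      dotProduct_single_one, Pi.add_apply, Pi.smul_apply, Matrix.row_apply, smul_eq_mul]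
    ring
  · simpa only [add_dotProduct, smul_dotProduct, single_one_dotProduct, smul_eq_mul] using hl

theorem IsCircularGaussian.hasLaw_apply {f : ι → Ω → ℂ} {Γ : Matrix ι ι ℂ}
    (hf : IsCircularGaussian μ f Γ) (i : ι) :
    ∃ v : ℝ≥0, ((v : ℝ) : ℂ) = Γ i i ∧ HasLaw (f i) (complexGaussian v) μ := by
  simpa using hf.hasLaw_add_mul i i 0

theorem IsCircularGaussian.aemeasurable {f : ι → Ω → ℂ} {Γ : Matrix ι ι ℂ}
    (hf : IsCircularGaussian μ f Γ) (i : ι) : AEMeasurable (f i) μ :=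
  let ⟨_, _, hl⟩ := hf.hasLaw_apply i
  hl.aemeasurable

theorem integral_norm_pow_of_hasLaw {X : Ω → ℂ} {v : ℝ≥0} (hX : HasLaw X (complexGaussian v) μ)
    (k : ℕ) : ∫ ω, ‖X ω‖ ^ (2 * k) ∂μ = k.factorial * (v : ℝ) ^ k := by
  rw [← integral_norm_pow_complexGaussian]
  exact hX.integral_comp (f := fun z => ‖z‖ ^ (2 * k)) (by fun_prop)

theorem integrable_norm_pow_of_hasLaw {X : Ω → ℂ} {v : ℝ≥0}
    (hX : HasLaw X (complexGaussian v) μ) (k : ℕ) : Integrable (fun ω => ‖X ω‖ ^ (2 * k)) μ :=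
  (hX.map_eq ▸ integrable_norm_pow_complexGaussian v k).comp_aemeasurable hX.aemeasurable

theorem IsCircularGaussian.integral_norm_sq {f : ι → Ω → ℂ} {Γ : Matrix ι ι ℂ}
    (hf : IsCircularGaussian μ f Γ) (i : ι) : ((∫ ω, ‖f i ω‖ ^ 2 ∂μ : ℝ) : ℂ) = Γ i i := by
  obtain ⟨v, hv, hl⟩ := hf.hasLaw_apply i
  rw [← hv]
  simpa using integral_norm_pow_of_hasLaw hl 1

theorem IsCircularGaussian.memLp_norm_sq {f : ι → Ω → ℂ} {Γ : Matrix ι ι ℂ}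
    (hf : IsCircularGaussian μ f Γ) (i : ι) : MemLp (fun ω => ‖f i ω‖ ^ 2) 2 μ := by
  obtain ⟨v, -, hl⟩ := hf.hasLaw_apply i
  rw [memLp_two_iff_integrable_sq (hl.aemeasurable.norm.pow_const 2).aestronglyMeasurable]
  simpa only [← pow_mul] using integrable_norm_pow_of_hasLaw hl 2

theorem sixteen_mul_norm_sq_mul_norm_sq (a b : ℂ) :
    16 * (‖a‖ ^ 2 * ‖b‖ ^ 2) =
      ∑ n : Fin 4, ‖a + Complex.I ^ (n : ℕ) * b‖ ^ 4 - 4 * ‖a‖ ^ 4 - 4 * ‖b‖ ^ 4 := by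
  simp only [show 4 = 2 * 2 from rfl, pow_mul, ← Complex.normSq_eq_norm_sq, Complex.normSq_apply]
  simp only [Complex.add_re, Complex.mul_re, Complex.add_im, Complex.mul_im, Fin.sum_univ_four,
    Fin.isValue, Fin.coe_ofNat_eq_mod, Nat.zero_mod, pow_zero, Complex.one_re, Complex.one_im,
    Nat.one_mod, pow_one, Complex.I_re, Complex.I_im, Nat.reduceMod, Complex.I_sq, Complex.neg_re,
    Complex.neg_im, Nat.mod_succ, Complex.I_pow_three]
  ring

theorem sum_two_mul_sq_sub (p q r s : ℂ) :
    ∑ n : Fin 4, 2 * (p + star (Complex.I ^ (n : ℕ)) * q + Complex.I ^ (n : ℕ) * r +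
      Complex.I ^ (n : ℕ) * star (Complex.I ^ (n : ℕ)) * s) ^ 2 - 4 * (2 * p ^ 2) -
      4 * (2 * s ^ 2) = 16 * (p * s + q * r) := by
  simp only [Fin.sum_univ_four, star_pow, RCLike.star_def, Complex.conj_I]
  simp only [Fin.isValue, Fin.coe_ofNat_eq_mod, Nat.reduceMod, pow_zero, pow_one, neg_sq,
    Complex.I_sq, Complex.I_pow_three, Odd.neg_pow (by decide : Odd 3)]
  linear_combination (4 * q ^ 2 + 4 * r ^ 2 - 8 * q * r - 8 * p * s +
    4 * s ^ 2 * (Complex.I ^ 2 - 1)) * Complex.I_sq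

theorem IsCircularGaussian.integral_norm_sq_mul_norm_sq {f : ι → Ω → ℂ} {Γ : Matrix ι ι ℂ}
    (hf : IsCircularGaussian μ f Γ) (j k : ι) :
    ((∫ ω, ‖f j ω‖ ^ 2 * ‖f k ω‖ ^ 2 ∂μ : ℝ) : ℂ) = Γ j j * Γ k k + Γ j k * Γ k j := by
  choose v hv hl using fun n : Fin 4 => hf.hasLaw_add_mul j k (Complex.I ^ (n : ℕ))
  obtain ⟨vj, hvj, hlj⟩ := hf.hasLaw_apply j
  obtain ⟨vk, hvk, hlk⟩ := hf.hasLaw_apply k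
  have hsum : Integrable (fun ω => ∑ n : Fin 4, ‖f j ω + Complex.I ^ (n : ℕ) * f k ω‖ ^ 4) μ :=
    integrable_finsetSum _ fun n _ => integrable_norm_pow_of_hasLaw (hl n) 2
  have hj := (integrable_norm_pow_of_hasLaw hlj 2).const_mul 4
  have hk := (integrable_norm_pow_of_hasLaw hlk 2).const_mul 4
  have hmoments : 16 * ∫ ω, ‖f j ω‖ ^ 2 * ‖f k ω‖ ^ 2 ∂μ =
      ∑ n, 2 * (v n : ℝ) ^ 2 - 4 * (2 * (vj : ℝ) ^ 2) - 4 * (2 * (vk : ℝ) ^ 2) := by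
    rw [← integral_const_mul]
    simp_rw [sixteen_mul_norm_sq_mul_norm_sq]
    rw [integral_sub (by exact hsum.sub hj) hk, integral_sub hsum hj,
      integral_finsetSum _ fun n _ => integrable_norm_pow_of_hasLaw (hl n) 2, integral_const_mul,
      integral_const_mul]
    simp [integral_norm_pow_of_hasLaw (hl _) 2, integral_norm_pow_of_hasLaw hlj 2,
      integral_norm_pow_of_hasLaw hlk 2]
  refine mul_left_cancel₀ (by norm_num : (16 : ℂ) ≠ 0) ?_
  have hcast := congrArg ((↑) : ℝ → ℂ) hmoments
  push_cast [hv, hvj, hvk] at hcast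
  exact hcast.trans (sum_two_mul_sq_sub _ _ _ _)

open scoped Matrix.Norms.Frobenius

theorem frobenius_norm_sq (A : Matrix ι κ ℂ) : ‖A‖ ^ 2 = ∑ i, ∑ j, ‖A i j‖ ^ 2 := by
  have h : 0 ≤ ∑ i, ∑ j, ‖A i j‖ ^ 2 := by positivity
  simp only [Matrix.frobenius_norm_def, Real.rpow_two]
  rw [← Real.sqrt_eq_rpow, Real.sq_sqrt h]

theorem norm_sum_sum_mul_le (A : Matrix ι ι ℂ) : ‖∑ j, ∑ k, A j k * A k j‖ ≤ ‖A‖ ^ 2 := by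
  calc ‖∑ j, ∑ k, A j k * A k j‖
      ≤ ∑ j, ∑ k, (‖A j k‖ ^ 2 + ‖A k j‖ ^ 2) / 2 :=
        norm_sum_le_of_le _ fun j _ => norm_sum_le_of_le _ fun k _ => by
          rw [norm_mul]
          linarith [two_mul_le_add_sq ‖A j k‖ ‖A k j‖]
    _ = ‖A‖ ^ 2 := by
        simp_rw [← Finset.sum_div, Finset.sum_add_distrib]
        rw [Finset.sum_comm (f := fun j k => ‖A k j‖ ^ 2), ← frobenius_norm_sq]
        ring

theorem IsCircularGaussian.memLp_sum_norm_sq {f : ι → Ω → ℂ} {Γ : Matrix ι ι ℂ}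
    (hf : IsCircularGaussian μ f Γ) : MemLp (fun ω => ∑ i, ‖f i ω‖ ^ 2) 2 μ :=
  memLp_finsetSum _ fun i _ => hf.memLp_norm_sq i

theorem IsCircularGaussian.covariance_norm_sq [IsProbabilityMeasure μ]
    {f : ι → Ω → ℂ} {Γ : Matrix ι ι ℂ} (hf : IsCircularGaussian μ f Γ) (j k : ι) :
    ((cov[fun ω => ‖f j ω‖ ^ 2, fun ω => ‖f k ω‖ ^ 2; μ] : ℝ) : ℂ) = Γ j k * Γ k j := by
  rw [covariance_eq_sub (hf.memLp_norm_sq j) (hf.memLp_norm_sq k)]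
  push_cast
  rw [hf.integral_norm_sq j, hf.integral_norm_sq k]
  exact sub_eq_of_eq_add' (hf.integral_norm_sq_mul_norm_sq j k)

theorem IsCircularGaussian.eLpNorm_sum_norm_sq_sub_trace_le [IsProbabilityMeasure μ]
    {f : ι → Ω → ℂ} {Γ : Matrix ι ι ℂ} (hf : IsCircularGaussian μ f Γ) :
    eLpNorm (fun ω => ∑ i, ‖f i ω‖ ^ 2 - Γ.trace.re) 2 μ ≤ ENNReal.ofReal ‖Γ‖ := by
  have hmean : ∫ ω, ∑ i, ‖f i ω‖ ^ 2 ∂μ = Γ.trace.re := by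
    rw [integral_finsetSum _ fun i _ => (hf.memLp_norm_sq i).integrable one_le_two,
      Matrix.trace, Complex.re_sum]
    exact Finset.sum_congr rfl fun i _ => by
      rw [Matrix.diag_apply, ← hf.integral_norm_sq i, Complex.ofReal_re]
  have hvar : Var[fun ω => ∑ i, ‖f i ω‖ ^ 2; μ] ≤ ‖Γ‖ ^ 2 := by
    rw [variance_fun_sum' fun i _ => hf.memLp_norm_sq i]
    refine le_trans (le_trans (le_abs_self _) (Eq.le ?_)) (norm_sum_sum_mul_le Γ)
    simp_rw [← Real.norm_eq_abs, ← Complex.norm_real, Complex.ofReal_sum, hf.covariance_norm_sq]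
  have hmem := hf.memLp_sum_norm_sq
  rw [variance_eq_integral hmem.aemeasurable, hmean] at hvar
  have hsub : MemLp (fun ω => ∑ i, ‖f i ω‖ ^ 2 - Γ.trace.re) 2 μ := hmem.sub (memLp_const _)
  rw [hsub.eLpNorm_eq_integral_rpow_norm two_ne_zero ENNReal.ofNat_ne_top]
  refine ENNReal.ofReal_le_ofReal ?_
  simp only [ENNReal.toReal_ofNat, Real.rpow_two, Real.norm_eq_abs, sq_abs]
  exact (Real.rpow_inv_le_iff_of_pos (by positivity) (norm_nonneg _) two_pos).2
    (by simpa using hvar)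

end CircularGaussian

section LaplaceTransform

variable {Ω : Type*} [MeasurableSpace Ω] {μ : Measure Ω} {ι : Type*} [Fintype ι]

theorem integral_exp_re_mul_I_complexGaussian (v : ℝ≥0) (t : ℂ) :
    ∫ z, Complex.exp ((z * t).re * Complex.I) ∂complexGaussian v =
      Complex.exp (-(v * ‖t‖ ^ 2 / 4 : ℝ)) := by
  rw [← norm_star t, ← charFun_complexGaussian, charFun_apply]
  simp [Complex.inner, mul_comm]

theorem integral_exp_re_dotProduct_pi_complexGaussian (v : ℝ≥0) (t : ι → ℂ) :
    ∫ a, Complex.exp ((a ⬝ᵥ t).re * Complex.I) ∂Measure.pi (fun _ => complexGaussian v) =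
      Complex.exp (-(v * (∑ i, ‖t i‖ ^ 2) / 4 : ℝ)) := by
  have hprod (a : ι → ℂ) : Complex.exp ((a ⬝ᵥ t).re * Complex.I) =
      ∏ i, Complex.exp ((a i * t i).re * Complex.I) := by
    rw [dotProduct, Complex.re_sum, Complex.ofReal_sum, Finset.sum_mul, Complex.exp_sum]
  simp_rw [hprod]
  rw [integral_fintype_prod_eq_prod
    (f := fun i (z : ℂ) => Complex.exp ((z * t i).re * Complex.I))]
  simp_rw [integral_exp_re_mul_I_complexGaussian]
  rw [← Complex.exp_sum, Finset.mul_sum, Finset.sum_div]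
  push_cast
  rw [Finset.sum_neg_distrib]

theorem IsCircularGaussian.integral_exp_re_dotProduct {f : ι → Ω → ℂ} {Γ : Matrix ι ι ℂ}
    (hf : IsCircularGaussian μ f Γ) (a : ι → ℂ) :
    ∫ ω, Complex.exp ((a ⬝ᵥ fun i => f i ω).re * Complex.I) ∂μ =
      (Real.exp (-(((a ᵥ* Γ) ⬝ᵥ star a).re / 4)) : ℂ) := by
  obtain ⟨v, hv, hl⟩ := isCircularGaussian_iff.1 hf a
  have h := integral_exp_re_mul_I_complexGaussian v 1
  simp only [mul_one] at h
  rw [← hv, Complex.ofReal_re]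
  refine (hl.integral_comp (f := fun z => Complex.exp (z.re * Complex.I))
    (Continuous.aestronglyMeasurable (by fun_prop))).trans (h.trans ?_)
  simp

/-- Fubini for `exp (i Re (a ⬝ᵥ f))`, with `a` Gaussian and independent of `f`. -/
theorem IsCircularGaussian.integral_exp_neg_sum_norm_sq [IsProbabilityMeasure μ]
    {f : ι → Ω → ℂ} {Γ : Matrix ι ι ℂ} (hf : IsCircularGaussian μ f Γ) (l : ℝ≥0) :
    ∫ ω, Real.exp (-(l * ∑ i, ‖f i ω‖ ^ 2)) ∂μ =
      ∫ a, Real.exp (-(((a ᵥ* Γ) ⬝ᵥ star a).re / 4))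
        ∂Measure.pi fun _ : ι => complexGaussian (4 * l) := by
  have hmeas : AEStronglyMeasurable (fun p : Ω × (ι → ℂ) =>
      Complex.exp ((p.2 ⬝ᵥ fun i => f i p.1).re * Complex.I))
      (μ.prod (Measure.pi fun _ => complexGaussian (4 * l))) := by
    refine Continuous.comp_aestronglyMeasurable (g := fun z : ℂ => Complex.exp (z.re * Complex.I))
      (by fun_prop) (Finset.aemeasurable_fun_sum _ fun i _ => ?_).aestronglyMeasurable
    exact AEMeasurable.mul (by fun_prop) (hf.aemeasurable i).comp_fst
  have hint := Integrable.of_bound hmeas 1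
    (ae_of_all _ fun p => (Complex.norm_exp_ofReal_mul_I _).le)
  apply Complex.ofReal_injective
  rw [← integral_complex_ofReal, ← integral_complex_ofReal]
  simp_rw [← hf.integral_exp_re_dotProduct]
  rw [← integral_integral_swap hint]
  simp_rw [integral_exp_re_dotProduct_pi_complexGaussian]
  push_cast
  simp [mul_assoc, mul_div_cancel_left₀]

theorem IsCircularGaussian.integral_exp_neg_sum_norm_sq_le [IsProbabilityMeasure μ]
    {f : ι → Ω → ℂ} {Γ : Matrix ι ι ℂ} (hf : IsCircularGaussian μ f Γ) {s : ℝ} (hs : 0 ≤ s)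
    (hΓ : ∀ a, s * ∑ i, ‖a i‖ ^ 2 ≤ ((a ᵥ* Γ) ⬝ᵥ star a).re) (l : ℝ≥0) :
    ∫ ω, Real.exp (-(l * ∑ i, ‖f i ω‖ ^ 2)) ∂μ ≤ ((1 + l * s) ^ Fintype.card ι)⁻¹ := by
  have hint {g : (ι → ℂ) → ℝ} (hg : Continuous g) (hg0 : ∀ a, 0 ≤ g a) :
      Integrable (fun a => Real.exp (-g a)) (Measure.pi fun _ : ι => complexGaussian (4 * l)) :=
    Integrable.of_bound (by fun_prop) 1 (ae_of_all _ fun a => by simpa using hg0 a)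
  have hnonneg (a : ι → ℂ) : 0 ≤ s * ∑ i, ‖a i‖ ^ 2 := by positivity
  calc ∫ ω, Real.exp (-(l * ∑ i, ‖f i ω‖ ^ 2)) ∂μ
      = ∫ a, Real.exp (-(((a ᵥ* Γ) ⬝ᵥ star a).re / 4))
          ∂Measure.pi fun _ : ι => complexGaussian (4 * l) := hf.integral_exp_neg_sum_norm_sq l
    _ ≤ ∫ a, Real.exp (-(s * (∑ i, ‖a i‖ ^ 2) / 4))
          ∂Measure.pi fun _ : ι => complexGaussian (4 * l) := by
        refine integral_mono (hint (by fun_prop) fun a => ?_) (hint (by fun_prop) fun a => ?_)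
          fun a => ?_
        · exact div_nonneg ((hnonneg a).trans (hΓ a)) zero_le_four
        · exact div_nonneg (hnonneg a) zero_le_four
        · dsimp only
          gcongr
          exact hΓ a
    _ = ∫ a, ∏ i, Real.exp (-(s / 4) * ‖a i‖ ^ 2)
          ∂Measure.pi fun _ : ι => complexGaussian (4 * l) := by
        simp_rw [← Real.exp_sum, ← Finset.mul_sum]
        congr! 3
        ring
    _ = ((1 + l * s) ^ Fintype.card ι)⁻¹ := by
        rw [integral_fintype_prod_eq_prod (f := fun _ z => Real.exp (-(s / 4) * ‖z‖ ^ 2))]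
        simp_rw [integral_exp_neg_mul_norm_sq_complexGaussian _ (show 0 ≤ s / 4 by positivity)]
        rw [Finset.prod_const, inv_pow, Finset.card_univ]
        push_cast
        ring

end LaplaceTransform

theorem lintegral_sq_lintegral_le {α β : Type*} [MeasurableSpace α] [MeasurableSpace β]
    {μ : Measure α} {ν : Measure β} [SFinite μ] [SFinite ν] {F : α → β → ℝ≥0∞}
    (hF : AEMeasurable (Function.uncurry F) (μ.prod ν)) :
    ∫⁻ x, (∫⁻ y, F x y ∂ν) ^ 2 ∂μ ≤ (∫⁻ y, (∫⁻ x, F x y ^ (2 : ℝ) ∂μ) ^ (1 / 2 : ℝ) ∂ν) ^ 2 := by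
  set G : α → ℝ≥0∞ := fun x => ∫⁻ y, F x y ∂ν
  set A : β → ℝ≥0∞ := fun y => (∫⁻ x, F x y ^ (2 : ℝ) ∂μ) ^ (1 / 2 : ℝ)
  have hG : AEMeasurable G μ := hF.lintegral_prod_right'
  have hA : AEMeasurable A ν := (hF.pow_const (2 : ℝ)).lintegral_prod_left'.pow_const _
  have hleft : ∀ᵐ x ∂μ, AEMeasurable (F x) ν :=
    hF.aestronglyMeasurable.prodMk_left.mono fun _ h => h.aemeasurable
  have hright : ∀ᵐ y ∂ν, AEMeasurable (fun x => F x y) μ :=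
    hF.aestronglyMeasurable.prodMk_right.mono fun _ h => h.aemeasurable
  have hFG (g : α → ℝ≥0∞) (hg : AEMeasurable g μ) :
      ∫⁻ x, G x * g x ∂μ = ∫⁻ y, ∫⁻ x, F x y * g x ∂μ ∂ν := by
    rw [← lintegral_lintegral_swap (hF.mul hg.comp_fst)]
    exact lintegral_congr_ae (hleft.mono fun x hx => (lintegral_mul_const'' _ hx).symm)
  have hholder : ∀ᵐ y ∂ν, ∀ᵐ y' ∂ν, ∫⁻ x, F x y' * F x y ∂μ ≤ A y' * A y :=
    hright.mono fun y hy => hright.mono fun y' hy' =>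
      ENNReal.lintegral_mul_le_Lp_mul_Lq μ Real.HolderConjugate.two_two hy' hy
  calc ∫⁻ x, G x ^ 2 ∂μ = ∫⁻ y, ∫⁻ x, G x * F x y ∂μ ∂ν := by
        simp_rw [sq, hFG G hG, mul_comm]
    _ = ∫⁻ y, ∫⁻ y', ∫⁻ x, F x y' * F x y ∂μ ∂ν ∂ν :=
        lintegral_congr_ae (hright.mono fun y hy => hFG _ hy)
    _ ≤ ∫⁻ y, ∫⁻ y', A y' * A y ∂ν ∂ν :=
        lintegral_mono_ae (hholder.mono fun y hy => lintegral_mono_ae hy)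
    _ = (∫⁻ y, A y ∂ν) ^ 2 := by
        simp_rw [lintegral_mul_const'' _ hA]
        rw [lintegral_const_mul'' _ hA, sq]

section GaussianIntegral

variable {κ ι : Type*} [Fintype κ] [Fintype ι]

theorem lintegral_exp_neg_sum_norm_sq :
    ∫⁻ z : κ → ℂ, ENNReal.ofReal (Real.exp (-∑ k, ‖z k‖ ^ 2)) =
      ENNReal.ofReal (Real.pi ^ Fintype.card κ) := by
  have hint : ∫ z : ℂ, Real.exp (-‖z‖ ^ 2) = Real.pi := by
    have h := GaussianFourier.integral_rexp_neg_mul_sq_norm (V := ℂ) one_pos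
    simpa [Complex.finrank_real_complex] using h
  have hprod : ∫ z : κ → ℂ, Real.exp (-∑ k, ‖z k‖ ^ 2) = Real.pi ^ Fintype.card κ := by
    simp_rw [← Finset.sum_neg_distrib, Real.exp_sum]
    rw [integral_fintype_prod_volume_eq_pow (fun z : ℂ => Real.exp (-‖z‖ ^ 2)), hint]
  rw [← hprod, ofReal_integral_eq_lintegral_ofReal _ (ae_of_all _ fun _ => (Real.exp_pos _).le)]
  refine Integrable.of_integral_ne_zero ?_
  rw [hprod]
  positivity

theorem det_restrictScalars_vecMulLinear [DecidableEq κ] (B : Matrix κ κ ℂ) :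
    LinearMap.det (B.vecMulLinear.restrictScalars ℝ) = ‖B.det‖ ^ 2 := by
  have h : B.vecMulLinear = Matrix.toLin' Bᵀ := by
    ext
    simp
  rw [LinearMap.det_restrictScalars, h, LinearMap.det_toLin', Matrix.det_transpose,
    Algebra.norm_complex_apply, Complex.normSq_eq_norm_sq]

theorem lintegral_exp_neg_sum_norm_sq_vecMul [DecidableEq κ] {B : Matrix κ κ ℂ} (hB : B.det ≠ 0) :
    ∫⁻ z : κ → ℂ, ENNReal.ofReal (Real.exp (-∑ k, ‖(z ᵥ* B) k‖ ^ 2)) =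
      ENNReal.ofReal (Real.pi ^ Fintype.card κ / ‖B.det‖ ^ 2) := by
  have hdet : LinearMap.det (B.vecMulLinear.restrictScalars ℝ) ≠ 0 := by
    rw [det_restrictScalars_vecMulLinear]
    positivity
  have hmeas : Measurable (B.vecMulLinear.restrictScalars ℝ) :=
    (LinearMap.continuous_of_finiteDimensional _).measurable
  have hmap := lintegral_map (μ := volume)
    (f := fun z : κ → ℂ => ENNReal.ofReal (Real.exp (-∑ k, ‖z k‖ ^ 2))) (by fun_prop) hmeas
  rw [Measure.map_linearMap_addHaar_eq_smul_addHaar _ hdet, lintegral_smul_measure,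
    lintegral_exp_neg_sum_norm_sq, det_restrictScalars_vecMulLinear, smul_eq_mul,
    ← ENNReal.ofReal_mul (by positivity), abs_of_nonneg (by positivity)] at hmap
  rw [div_eq_inv_mul, hmap]
  rfl

theorem sum_norm_sq_vecMul (y : Matrix κ ι ℂ) (z : κ → ℂ) :
    ((∑ i, ‖(z ᵥ* y) i‖ ^ 2 : ℝ) : ℂ) = (z ᵥ* (y * yᴴ)) ⬝ᵥ star z := by
  rw [← Matrix.vecMul_vecMul, ← Matrix.dotProduct_mulVec, ← Matrix.star_vecMul, dotProduct]
  simp [Complex.mul_conj, Complex.normSq_eq_norm_sq]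

open scoped ComplexOrder MatrixOrder in
theorem inv_norm_det_le [DecidableEq κ] {C : Matrix κ κ ℂ} (hC : C.PosSemidef) :
    ENNReal.ofReal ‖C.det‖⁻¹ ≤ ENNReal.ofReal (Real.pi ^ Fintype.card κ)⁻¹ *
      ∫⁻ z : κ → ℂ, ENNReal.ofReal (Real.exp (-((z ᵥ* C) ⬝ᵥ star z).re)) := by
  obtain ⟨B, rfl⟩ : ∃ B : Matrix κ κ ℂ, C = B * Bᴴ :=
    CStarAlgebra.nonneg_iff_eq_mul_star_self.1 hC.nonneg
  have hdet : ‖(B * Bᴴ).det‖ = ‖B.det‖ ^ 2 := by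
    rw [Matrix.det_mul, Matrix.det_conjTranspose, norm_mul, norm_star, sq]
  simp_rw [← sum_norm_sq_vecMul, Complex.ofReal_re]
  rcases eq_or_ne B.det 0 with h | h
  · simp [h]
  · rw [lintegral_exp_neg_sum_norm_sq_vecMul h, ← ENNReal.ofReal_mul (by positivity), hdet,
      inv_mul_eq_div, div_div_cancel_left' (by positivity)]

end GaussianIntegral

section InverseDeterminant

theorem one_add_div_pow_le_one_add_div_pow {m n : ℕ} (hm : m ≠ 0) (hmn : m ≤ n) {y : ℝ}
    (hy : 0 ≤ y) : (1 + y / m) ^ m ≤ (1 + y / n) ^ n := by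
  have hm0 : (0 : ℝ) < m := by positivity
  have hn0 : (0 : ℝ) < n := hm0.trans_le (by exact_mod_cast hmn)
  have hbernoulli : 1 + y / m ≤ (1 + y / n) ^ ((n : ℝ) / m) := by
    have h := one_add_mul_self_le_rpow_one_add (s := y / n)
      ((neg_one_lt_zero.le).trans (by positivity)) (p := (n : ℝ) / m)
      ((one_le_div hm0).2 (by exact_mod_cast hmn))
    convert h using 2
    field_simp
  calc (1 + y / m) ^ m ≤ ((1 + y / n) ^ ((n : ℝ) / m)) ^ m := by gcongr
    _ = (1 + y / n) ^ n := by
      rw [← Real.rpow_mul_natCast (by positivity), div_mul_cancel₀ _ hm0.ne', Real.rpow_natCast]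

variable {κ : Type*} [Fintype κ]

/-- A bound, independent of the sample size, for the second moment of the inverse determinant
of a sample covariance matrix whose population covariance dominates `s`.
The exponent exceeds the real dimension of `κ → ℂ` by one, for integrability. -/
noncomputable def invDetBound (κ : Type*) [Fintype κ] (s : ℝ) : ℝ≥0∞ :=
  (ENNReal.ofReal (Real.pi ^ Fintype.card κ)⁻¹ * ∫⁻ z : κ → ℂ, ENNReal.ofReal
    ((1 + 2 * s * ‖z‖ ^ 2 / (2 * Fintype.card κ + 1 : ℕ)) ^ (2 * Fintype.card κ + 1))⁻¹ ^
      (1 / 2 : ℝ)) ^ 2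

theorem invDetBound_ne_top {s : ℝ} (hs : 0 < s) : invDetBound κ s ≠ ∞ := by
  set m := 2 * Fintype.card κ + 1 with hm
  set c := √(2 * s / m)
  have hc : c ≠ 0 := by positivity
  have hdim : (Module.finrank ℝ (κ → ℂ) : ℝ) < m := by
    rw [Module.finrank_pi_fintype]
    simp [hm, mul_comm]
  have hint :=
    ((integrable_rpow_neg_one_add_norm_sq (μ := volume) hdim).comp_smul hc).lintegral_lt_top
  refine ENNReal.pow_ne_top (ENNReal.mul_ne_top ENNReal.ofReal_ne_top ?_)
  convert hint.ne using 4 with z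
  have hcz : ‖c • z‖ ^ 2 = 2 * s * ‖z‖ ^ 2 / m := by
    rw [norm_smul, mul_pow, Real.norm_eq_abs, sq_abs, Real.sq_sqrt (by positivity)]
    ring
  rw [hcz, ENNReal.ofReal_rpow_of_nonneg (by positivity) (by positivity), neg_div,
    Real.rpow_neg (by positivity), Real.inv_rpow (by positivity), ← Real.rpow_natCast_mul
    (by positivity), mul_one_div]

open scoped ComplexOrder in
theorem inv_norm_det_inv_natCast_smul_le [DecidableEq κ] {ι : Type*} [Fintype ι]
    (y : Matrix κ ι ℂ) (n : ℕ) :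
    ENNReal.ofReal ‖((n : ℂ)⁻¹ • (y * yᴴ)).det‖⁻¹ ≤
      ENNReal.ofReal (Real.pi ^ Fintype.card κ)⁻¹ * ∫⁻ z : κ → ℂ,
        ENNReal.ofReal (Real.exp (-((n : ℝ)⁻¹ * ∑ i, ‖(z ᵥ* y) i‖ ^ 2))) := by
  have hn : (0 : ℂ) ≤ (n : ℂ)⁻¹ := inv_nonneg.2 n.cast_nonneg
  convert inv_norm_det_le ((Matrix.posSemidef_self_mul_conjTranspose y).smul hn) using 7 with z
  rw [Matrix.vecMul_smul, smul_dotProduct, ← sum_norm_sq_vecMul, smul_eq_mul,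
    ← Complex.ofReal_natCast, ← Complex.ofReal_inv, ← Complex.ofReal_mul, Complex.ofReal_re]

theorem IsCircularGaussian.lintegral_exp_neg_sq_le {Ω ι : Type*} [MeasurableSpace Ω]
    {μ : Measure Ω} [IsProbabilityMeasure μ] [Fintype ι] {f : ι → Ω → ℂ} {Γ : Matrix ι ι ℂ}
    (hf : IsCircularGaussian μ f Γ) {s : ℝ} (hs : 0 ≤ s)
    (hΓ : ∀ a, s * ∑ i, ‖a i‖ ^ 2 ≤ ((a ᵥ* Γ) ⬝ᵥ star a).re) {m : ℕ} (hm : m ≠ 0)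
    (hcard : m ≤ Fintype.card ι) :
    ∫⁻ ω, ENNReal.ofReal (Real.exp (-((Fintype.card ι : ℝ)⁻¹ * ∑ i, ‖f i ω‖ ^ 2))) ^ (2 : ℝ) ∂μ ≤
      ENNReal.ofReal ((1 + 2 * s / m) ^ m)⁻¹ := by
  set n := Fintype.card ι
  have hlaplace := hf.integral_exp_neg_sum_norm_sq_le hs hΓ (2 / n)
  push_cast at hlaplace
  calc ∫⁻ ω, ENNReal.ofReal (Real.exp (-((n : ℝ)⁻¹ * ∑ i, ‖f i ω‖ ^ 2))) ^ (2 : ℝ) ∂μ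
      = ∫⁻ ω, ENNReal.ofReal (Real.exp (-(2 / n * ∑ i, ‖f i ω‖ ^ 2))) ∂μ := by
        refine lintegral_congr fun ω => ?_
        rw [ENNReal.rpow_two, ← ENNReal.ofReal_pow (Real.exp_pos _).le, ← Real.exp_nat_mul]
        push_cast
        ring_nf
    _ = ENNReal.ofReal (∫ ω, Real.exp (-(2 / n * ∑ i, ‖f i ω‖ ^ 2)) ∂μ) := by
        have (i : ι) := hf.aemeasurable i
        refine (ofReal_integral_eq_lintegral_ofReal (Integrable.of_bound ?_ 1 (ae_of_all _
          fun ω => ?_)) (ae_of_all _ fun _ => (Real.exp_pos _).le)).symm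
        · exact AEMeasurable.aestronglyMeasurable (by fun_prop)
        · rw [Real.norm_eq_abs, Real.abs_exp, Real.exp_le_one_iff, neg_nonpos]
          positivity
    _ ≤ ENNReal.ofReal ((1 + 2 * s / m) ^ m)⁻¹ := by
        refine ENNReal.ofReal_le_ofReal (hlaplace.trans (inv_anti₀ (by positivity) ?_))
        rw [div_mul_eq_mul_div]
        exact one_add_div_pow_le_one_add_div_pow hm hcard (by positivity)

theorem lintegral_inv_norm_det_sq_le [DecidableEq κ] {Ω ι : Type*} [MeasurableSpace Ω]
    {μ : Measure Ω} [IsProbabilityMeasure μ] [Fintype ι] {y : Ω → Matrix κ ι ℂ}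
    {Γ : (κ → ℂ) → Matrix ι ι ℂ} {s : ℝ} (hs : 0 ≤ s)
    (hy : ∀ z, IsCircularGaussian μ (fun i ω => (z ᵥ* y ω) i) (Γ z))
    (hΓ : ∀ z a, s * (∑ k, ‖z k‖ ^ 2) * ∑ i, ‖a i‖ ^ 2 ≤ ((a ᵥ* Γ z) ⬝ᵥ star a).re)
    (hcard : 2 * Fintype.card κ + 1 ≤ Fintype.card ι) :
    ∫⁻ ω, ENNReal.ofReal ‖((Fintype.card ι : ℂ)⁻¹ • (y ω * (y ω)ᴴ)).det‖⁻¹ ^ 2 ∂μ ≤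
      invDetBound κ s := by
  set F : Ω → (κ → ℂ) → ℝ≥0∞ := fun ω z => ENNReal.ofReal
    (Real.exp (-((Fintype.card ι : ℝ)⁻¹ * ∑ i, ‖(z ᵥ* y ω) i‖ ^ 2)))
  have hentry (k : κ) (i : ι) : AEMeasurable (fun ω => y ω k i) μ := by
    simpa using (hy (Pi.single k 1)).aemeasurable i
  have hF : AEMeasurable (Function.uncurry F) (μ.prod volume) := by
    have (k : κ) (i : ι) : AEMeasurable (fun p : Ω × (κ → ℂ) => y p.1 k i) (μ.prod volume) :=
      (hentry k i).comp_fst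
    simp only [F, Function.uncurry_def, Matrix.vecMul, dotProduct]
    fun_prop
  calc ∫⁻ ω, ENNReal.ofReal ‖((Fintype.card ι : ℂ)⁻¹ • (y ω * (y ω)ᴴ)).det‖⁻¹ ^ 2 ∂μ
      ≤ ∫⁻ ω, (ENNReal.ofReal (Real.pi ^ Fintype.card κ)⁻¹ * ∫⁻ z, F ω z) ^ 2 ∂μ := by
        gcongr with ω
        exact inv_norm_det_inv_natCast_smul_le (y ω) _
    _ ≤ (ENNReal.ofReal (Real.pi ^ Fintype.card κ)⁻¹ *
          ∫⁻ z, (∫⁻ ω, F ω z ^ (2 : ℝ) ∂μ) ^ (1 / 2 : ℝ)) ^ 2 := by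
        simp_rw [mul_pow]
        rw [lintegral_const_mul' _ _ (by finiteness)]
        gcongr
        exact lintegral_sq_lintegral_le hF
    _ ≤ invDetBound κ s := by
        rw [invDetBound]
        gcongr with z
        refine ((hy z).lintegral_exp_neg_sq_le (by positivity) (hΓ z) (by simp) hcard).trans ?_
        rw [mul_assoc 2 s]
        gcongr
        rw [← Real.le_sqrt (norm_nonneg z) (by positivity)]
        exact (pi_norm_le_iff_of_nonneg (Real.sqrt_nonneg _)).2 fun k => Real.le_sqrt_of_sq_le
          (Finset.single_le_sum (fun k _ => sq_nonneg ‖z k‖) (Finset.mem_univ k))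

end InverseDeterminant

section WienerLemma

theorem tendsto_geom_sum_div {z : ℂ} (hz : ‖z‖ = 1) (hz1 : z ≠ 1) :
    Tendsto (fun n : ℕ => (∑ m ∈ Finset.range n, z ^ m) / n) atTop (𝓝 0) := by
  rw [tendsto_zero_iff_norm_tendsto_zero]
  refine squeeze_zero (fun _ => norm_nonneg _) (fun n => ?_)
    (tendsto_const_div_atTop_nhds_zero_nat (2 / ‖z - 1‖))
  rw [norm_div, Complex.norm_natCast, geom_sum_eq hz1, norm_div]
  gcongr
  calc ‖z ^ n - 1‖ ≤ ‖z ^ n‖ + ‖(1 : ℂ)‖ := norm_sub_le _ _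
    _ = 2 := by rw [norm_pow, hz]; norm_num

theorem norm_geom_sum_div_le_one {z : ℂ} (hz : ‖z‖ = 1) (n : ℕ) :
    ‖(∑ m ∈ Finset.range n, z ^ m) / n‖ ≤ 1 := by
  rw [norm_div, Complex.norm_natCast]
  refine div_le_one_of_le₀ ((norm_sum_le _ _).trans ?_) (by positivity)
  simp [hz]

variable {α : Type*} [MeasurableSpace α] {ν : Measure α}

theorem norm_integral_sq_eq_integral_prod [SFinite ν] (f : α → ℂ) :
    ((‖∫ x, f x ∂ν‖ ^ 2 : ℝ) : ℂ) = ∫ p, f p.1 * star (f p.2) ∂ν.prod ν := by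
  have hstar : ∫ x, star (f x) ∂ν = star (∫ x, f x ∂ν) := integral_conj
  rw [integral_prod_mul f fun x => star (f x), hstar, RCLike.star_def, Complex.mul_conj,
    Complex.normSq_eq_norm_sq]

variable [IsFiniteMeasure ν] {z : α → ℂ}

theorem sum_norm_integral_pow_mul_star_pow_sq (hzm : Measurable z) (hz : ∀ x, ‖z x‖ = 1)
    (n : ℕ) :
    ∑ m : Fin n, ∑ k : Fin n, ‖∫ x, z x ^ (m : ℕ) * star (z x) ^ (k : ℕ) ∂ν‖ ^ 2 =
      ∫ p, ‖∑ m ∈ Finset.range n, (z p.1 * star (z p.2)) ^ m‖ ^ 2 ∂ν.prod ν := by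
  have hint (m k : Fin n) : Integrable (fun p : α × α => z p.1 ^ (m : ℕ) * star (z p.1) ^ (k : ℕ) *
      star (z p.2 ^ (m : ℕ) * star (z p.2) ^ (k : ℕ))) (ν.prod ν) := by
    refine Integrable.of_bound (Measurable.aestronglyMeasurable (by fun_prop)) 1
      (ae_of_all _ fun p => ?_)
    simp [hz]
  apply Complex.ofReal_injective
  rw [← integral_complex_ofReal]
  push_cast
  calc ∑ m : Fin n, ∑ k : Fin n, ((‖∫ x, z x ^ (m : ℕ) * star (z x) ^ (k : ℕ) ∂ν‖ : ℂ) ^ 2)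
      = ∫ p, ∑ m : Fin n, ∑ k : Fin n, z p.1 ^ (m : ℕ) * star (z p.1) ^ (k : ℕ) *
          star (z p.2 ^ (m : ℕ) * star (z p.2) ^ (k : ℕ)) ∂ν.prod ν := by
        rw [integral_finsetSum _ fun m _ => integrable_finsetSum _ fun k _ => hint m k]
        refine Finset.sum_congr rfl fun m _ => ?_
        rw [integral_finsetSum _ fun k _ => hint m k]
        refine Finset.sum_congr rfl fun k _ => ?_
        exact_mod_cast norm_integral_sq_eq_integral_prod
          fun x => z x ^ (m : ℕ) * star (z x) ^ (k : ℕ)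
    _ = _ := by
        refine integral_congr_ae (ae_of_all _ fun p => ?_)
        dsimp only
        rw [← Complex.mul_conj', ← Fin.sum_univ_eq_sum_range, map_sum, Finset.sum_mul_sum]
        simp only [star_mul', star_pow, RCLike.star_def, map_mul, map_pow, mul_pow,
          Complex.conj_conj]
        refine Finset.sum_congr rfl fun m _ => Finset.sum_congr rfl fun k _ => ?_
        ring

theorem ae_mul_star_ne_one (hzm : Measurable z) (hz : ∀ x, ‖z x‖ = 1)
    (hν : ∀ c, ν {x | z x = c} = 0) : ∀ᵐ p ∂ν.prod ν, z p.1 * star (z p.2) ≠ 1 := by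
  have hms : MeasurableSet {p : α × α | z p.1 * star (z p.2) ≠ 1} :=
    (measurableSet_eq_fun (by fun_prop) measurable_const).compl
  rw [Measure.ae_prod_iff_ae_ae hms]
  refine ae_of_all _ fun x => measure_mono_null (fun y hy => ?_) (hν (z x))
  have hxy : z x * star (z y) = 1 := not_not.1 hy
  calc z y = z x * star (z y) * z y := by rw [hxy, one_mul]
    _ = z x := by
      rw [mul_assoc, mul_comm (star _), RCLike.star_def, Complex.mul_conj,
        Complex.normSq_eq_norm_sq, hz]
      simp

theorem tendsto_mean_norm_integral_sq (hzm : Measurable z) (hz : ∀ x, ‖z x‖ = 1)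
    (hν : ∀ c, ν {x | z x = c} = 0) :
    Tendsto (fun n : ℕ => (∑ m : Fin n, ∑ k : Fin n,
      ‖∫ x, z x ^ (m : ℕ) * star (z x) ^ (k : ℕ) ∂ν‖ ^ 2) / (n : ℝ) ^ 2) atTop (𝓝 0) := by
  have hlim : Tendsto (fun n : ℕ => ∫ p, ‖(∑ m ∈ Finset.range n, (z p.1 * star (z p.2)) ^ m) / n‖
      ^ 2 ∂ν.prod ν) atTop (𝓝 (∫ _, 0 ∂ν.prod ν)) := by
    have hq (p : α × α) : ‖z p.1 * star (z p.2)‖ = 1 := by simp [hz]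
    refine tendsto_integral_of_dominated_convergence (fun _ => 1) (fun n => ?_)
      (integrable_const _) (fun n => ae_of_all _ fun p => ?_) ?_
    · exact Measurable.aestronglyMeasurable (by fun_prop)
    · rw [norm_pow, norm_norm]
      exact pow_le_one₀ (norm_nonneg _) (norm_geom_sum_div_le_one (hq p) n)
    · filter_upwards [ae_mul_star_ne_one hzm hz hν] with p hp
      simpa using (tendsto_geom_sum_div (hq p) hp).norm.pow 2
  rw [integral_zero] at hlim
  refine hlim.congr fun n => ?_
  simp_rw [norm_div, div_pow, Complex.norm_natCast]
  rw [integral_div, sum_norm_integral_pow_mul_star_pow_sq hzm hz]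

theorem countable_setOf_sin_eq (c : ℝ) : {t : ℝ | Real.sin t = c}.Countable := by
  by_cases hc : ∃ t, Real.sin t = c
  · obtain ⟨t₀, rfl⟩ := hc
    refine ((Set.countable_range fun k : ℤ => 2 * (k : ℝ) * Real.pi + t₀).union
      (Set.countable_range fun k : ℤ => (2 * (k : ℝ) + 1) * Real.pi - t₀)).mono fun t ht => ?_
    obtain ⟨k, hk | hk⟩ := Real.sin_eq_sin_iff.1 ht.symm
    · exact Or.inl ⟨k, hk.symm⟩
    · exact Or.inr ⟨k, hk.symm⟩
  · push Not at hc
    simp [hc]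

theorem countable_setOf_exp_mul_sin_eq {a : ℂ} (ha : a ≠ 0) (c : ℂ) :
    {t : ℝ | Complex.exp (a * Real.sin t) = c}.Countable := by
  have hexp : {w : ℂ | Complex.exp w = c}.Countable := by
    by_cases hc : ∃ w, Complex.exp w = c
    · obtain ⟨w₀, rfl⟩ := hc
      refine (Set.countable_range fun k : ℤ => w₀ + k * (2 * Real.pi * Complex.I)).mono
        fun w hw => ?_
      obtain ⟨k, hk⟩ := Complex.exp_eq_exp_iff_exists_int.1 hw
      exact ⟨k, hk.symm⟩
    · push Not at hc
      simp [hc]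
  refine (hexp.biUnion fun w _ => countable_setOf_sin_eq (w / a).re).mono fun t ht =>
    Set.mem_biUnion (x := a * Real.sin t) ht ?_
  rw [Set.mem_ofPred_eq, mul_div_cancel_left₀ _ ha, Complex.ofReal_re]

theorem tendsto_mean_norm_integral_exp_sin_sq {D : ℝ} (hD : D ≠ 0) {a b : ℝ} (hab : a ≤ b) :
    Tendsto (fun n : ℕ => (∑ m : Fin n, ∑ k : Fin n,
      ‖∫ t in a..b, Complex.exp (-(2 * Real.pi * Complex.I * D *
        (((m : ℕ) : ℂ) - ((k : ℕ) : ℂ)) * Real.sin t))‖ ^ 2) / (n : ℝ) ^ 2) atTop (𝓝 0) := by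
  let z (t : ℝ) : ℂ := Complex.exp (-(2 * Real.pi * Complex.I * D) * Real.sin t)
  have hz (t : ℝ) : ‖z t‖ = 1 := by
    rw [Complex.norm_exp]
    simp [-Complex.ofReal_sin]
  refine (tendsto_mean_norm_integral_sq (ν := volume.restrict (Set.Ioc a b)) (z := z)
    (by fun_prop) hz fun c => (countable_setOf_exp_mul_sin_eq ?_ c).measure_zero _).congr
    fun n => ?_
  · simp [hD, Real.pi_ne_zero]
  · congr! 6 with m _ k _
    rw [intervalIntegral.integral_of_le hab]
    congr! 2 with _
    simp only [z, RCLike.star_def, ← Complex.exp_conj, ← Complex.exp_nat_mul, ← Complex.exp_add,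
      map_neg, map_mul, Complex.conj_I, Complex.conj_ofReal, map_ofNat]
    ring_nf

end WienerLemma

section MeanSquare

variable {Ω E F : Type*} [MeasurableSpace Ω] {μ : Measure Ω} [NormedAddCommGroup E]
  [NormedAddCommGroup F]

/-- The random variables `f n` are square integrable and converge in mean square to the
constant `c`. -/
def TendstoInMeanSquare (μ : Measure Ω) (f : ℕ → Ω → E) (c : E) : Prop :=
  (∀ n, MemLp (f n) 2 μ) ∧ Tendsto (fun n => eLpNorm (fun ω => f n ω - c) 2 μ) atTop (𝓝 0)

theorem TendstoInMeanSquare.tendstoInMeasure {f : ℕ → Ω → E} {c : E}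
    (hf : TendstoInMeanSquare μ f c) : TendstoInMeasure μ f atTop fun _ => c :=
  tendstoInMeasure_of_tendsto_eLpNorm two_ne_zero (fun n => (hf.1 n).aestronglyMeasurable)
    aestronglyMeasurable_const hf.2

theorem TendstoInMeanSquare.unifIntegrable [IsFiniteMeasure μ] {f : ℕ → Ω → E} {c : E}
    (hf : TendstoInMeanSquare μ f c) : UnifIntegrable f 2 μ :=
  unifIntegrable_of_tendsto_Lp one_le_two (by simp) hf.1 (memLp_const c) hf.2

theorem TendstoInMeanSquare.comp_lipschitzWith [IsFiniteMeasure μ] {f : ℕ → Ω → E} {c : E}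
    (hf : TendstoInMeanSquare μ f c) {K : ℝ≥0} {φ : E → F} (hφ : LipschitzWith K φ) :
    TendstoInMeanSquare μ (fun n ω => φ (f n ω)) (φ c) := by
  have hle (n : ℕ) (ω : Ω) : ‖φ (f n ω) - φ c‖ ≤ K * ‖f n ω - c‖ := hφ.norm_sub_le _ _
  refine ⟨fun n => ?_, ?_⟩
  · have hdiff : MemLp (fun ω => φ (f n ω) - φ c) 2 μ :=
      ((hf.1 n).sub (memLp_const c)).of_le_mul ((hφ.continuous.comp_aestronglyMeasurable
        (hf.1 n).aestronglyMeasurable).sub aestronglyMeasurable_const) (ae_of_all _ (hle n))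
    exact (memLp_congr_ae (ae_of_all _ fun ω => sub_add_cancel _ _)).1
      (hdiff.add (memLp_const (φ c)))
  · have hK := ENNReal.Tendsto.const_mul (a := ENNReal.ofReal K) hf.2 (Or.inr (by simp))
    rw [mul_zero] at hK
    exact tendsto_of_tendsto_of_tendsto_of_le_of_le tendsto_const_nhds hK (fun _ => zero_le)
      fun n => eLpNorm_le_mul_eLpNorm_of_ae_le_mul (ae_of_all _ (hle n)) 2

theorem TendstoInMeanSquare.norm [IsFiniteMeasure μ] {f : ℕ → Ω → E} {c : E}
    (hf : TendstoInMeanSquare μ f c) :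
    TendstoInMeanSquare μ (fun n ω => ‖f n ω‖) ‖c‖ :=
  hf.comp_lipschitzWith lipschitzWith_one_norm

theorem tendstoInMeanSquare_pi [IsFiniteMeasure μ] {J : Type*} [Fintype J] {f : ℕ → Ω → J → E}
    {c : J → E} (hf : ∀ j, TendstoInMeanSquare μ (fun n ω => f n ω j) (c j)) :
    TendstoInMeanSquare μ f c := by
  refine ⟨fun n => MemLp.of_eval fun j => (hf j).1 n, ?_⟩
  have hsum : Tendsto (fun n => ∑ j, eLpNorm (fun ω => f n ω j - c j) 2 μ) atTop (𝓝 0) := by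
    simpa using tendsto_finsetSum Finset.univ fun j _ => (hf j).2
  refine tendsto_of_tendsto_of_tendsto_of_le_of_le tendsto_const_nhds hsum (fun _ => zero_le)
    fun n => ?_
  calc eLpNorm (fun ω => f n ω - c) 2 μ
      ≤ eLpNorm (∑ j, fun ω => ‖f n ω j - c j‖) 2 μ := by
        refine eLpNorm_mono_real fun ω => ?_
        rw [Finset.sum_apply, pi_norm_le_iff_of_nonneg (by positivity)]
        exact fun j => Finset.single_le_sum (f := fun j => ‖f n ω j - c j‖)
          (fun _ _ => norm_nonneg _) (Finset.mem_univ j)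
    _ ≤ ∑ j, eLpNorm (fun ω => ‖f n ω j - c j‖) 2 μ :=
        eLpNorm_sum_le (fun j _ => (((hf j).1 n).sub (memLp_const _)).norm.aestronglyMeasurable)
          one_le_two
    _ = ∑ j, eLpNorm (fun ω => f n ω j - c j) 2 μ := by simp only [eLpNorm_norm]

theorem tendstoInMeasure_comp_continuousAt {f : ℕ → Ω → E} {c : E}
    (hf : TendstoInMeasure μ f atTop fun _ => c) {φ : E → F} (hφ : ContinuousAt φ c) :
    TendstoInMeasure μ (fun n ω => φ (f n ω)) atTop fun _ => φ c := by
  intro ε hε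
  obtain ⟨δ, hδ, hball⟩ := EMetric.continuousAt_iff.1 hφ ε hε
  refine tendsto_of_tendsto_of_tendsto_of_le_of_le tendsto_const_nhds (hf δ hδ)
    (fun _ => zero_le) fun n => measure_mono fun ω hω => ?_
  by_contra hlt
  exact absurd (hball (not_le.1 hlt)) (not_lt.2 hω)

theorem unifIntegrable_mul {A B : ℕ → Ω → ℝ} {K : ℝ≥0}
    (hAm : ∀ n, AEStronglyMeasurable (A n) μ) (hA : UnifIntegrable A 2 μ)
    (hBm : ∀ n, AEStronglyMeasurable (B n) μ) (hB : ∀ n, eLpNorm (B n) 2 μ ≤ K) :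
    UnifIntegrable (fun n ω => A n ω * B n ω) 1 μ := by
  intro ε hε
  obtain ⟨δ, hδ, hA⟩ := hA (show 0 < ε / (K + 1) by positivity)
  refine ⟨δ, hδ, fun n s hs hμs => ?_⟩
  have hmul : s.indicator (fun ω => A n ω * B n ω) = s.indicator (A n) • B n := by
    ext ω
    simp [Set.indicator_mul_left]
  calc eLpNorm (s.indicator fun ω => A n ω * B n ω) 1 μ
      ≤ eLpNorm (s.indicator (A n)) 2 μ * eLpNorm (B n) 2 μ := by
        rw [hmul]
        exact eLpNorm_smul_le_mul_eLpNorm (hBm n) ((hAm n).indicator hs)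
    _ ≤ ENNReal.ofReal (ε / (K + 1)) * ENNReal.ofReal K := by
        rw [ENNReal.ofReal_coe_nnreal]
        exact mul_le_mul' (hA n s hs hμs) (hB n)
    _ ≤ ENNReal.ofReal ε := by
        rw [← ENNReal.ofReal_mul (by positivity)]
        refine ENNReal.ofReal_le_ofReal ?_
        rw [div_mul_eq_mul_div, div_le_iff₀ (by positivity)]
        linarith

theorem unifIntegrable_of_norm_le {p : ℝ≥0∞} {X : ℕ → Ω → E} {Z : ℕ → Ω → ℝ}
    (hZ : UnifIntegrable Z p μ) (hXZ : ∀ n ω, ‖X n ω‖ ≤ Z n ω) : UnifIntegrable X p μ := by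
  intro ε hε
  obtain ⟨δ, hδ, hZ⟩ := hZ hε
  refine ⟨δ, hδ, fun n s hs hμs => le_trans (eLpNorm_mono_real fun ω => ?_) (hZ n s hs hμs)⟩
  rw [norm_indicator_eq_indicator_norm]
  exact Set.indicator_le_indicator (hXZ n ω)

theorem integrable_and_tendsto_integral_of_le_mul_add [IsProbabilityMeasure μ] {X : ℕ → Ω → ℝ}
    {A B Q : ℕ → Ω → ℝ} {x a q : ℝ} {K : ℝ≥0} (hXm : ∀ n, AEStronglyMeasurable (X n) μ)
    (hX : TendstoInMeasure μ X atTop fun _ => x) (hA : TendstoInMeanSquare μ A a)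
    (hBm : ∀ n, AEStronglyMeasurable (B n) μ) (hB : ∀ n, eLpNorm (B n) 2 μ ≤ K)
    (hQ : TendstoInMeanSquare μ Q q) (hle : ∀ n ω, ‖X n ω‖ ≤ A n ω * B n ω + Q n ω) :
    (∀ n, Integrable (X n) μ) ∧ Tendsto (fun n => ∫ ω, X n ω ∂μ) atTop (𝓝 x) := by
  have hAm (n : ℕ) := (hA.1 n).aestronglyMeasurable
  have hint (n : ℕ) : Integrable (X n) μ := by
    have hAB : Integrable (fun ω => A n ω * B n ω) μ :=
      (hA.1 n).integrable_mul ⟨hBm n, (hB n).trans_lt ENNReal.coe_lt_top⟩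
    exact (hAB.add ((hQ.1 n).integrable one_le_two)).mono' (hXm n) (ae_of_all _ (hle n))
  have hunif : UnifIntegrable X 1 μ := by
    have hQ1 : UnifIntegrable Q 1 μ := by
      refine unifIntegrable_of_tendsto_Lp le_rfl (by simp) (fun n => (hQ.1 n).mono_exponent
        one_le_two) (memLp_const q) ?_
      exact tendsto_of_tendsto_of_tendsto_of_le_of_le tendsto_const_nhds hQ.2 (fun _ => zero_le)
        fun n => eLpNorm_le_eLpNorm_of_exponent_le one_le_two
          ((hQ.1 n).aestronglyMeasurable.sub aestronglyMeasurable_const)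
    exact unifIntegrable_of_norm_le ((unifIntegrable_mul hAm hA.unifIntegrable hBm hB).add hQ1
      le_rfl (fun n => (hAm n).mul (hBm n)) fun n => (hQ.1 n).aestronglyMeasurable) hle
  have hlim := tendsto_integral_of_L1' (μ := μ) (fun _ => x) aestronglyMeasurable_const
    (Eventually.of_forall hint)
    (tendsto_Lp_finite_of_tendstoInMeasure le_rfl (by simp) hXm (memLp_const x) hunif hX)
  exact ⟨hint, by simpa using hlim⟩

end MeanSquare

section LinearMap

variable {Ω E F : Type*} [MeasurableSpace Ω] {μ : Measure Ω} [IsFiniteMeasure μ]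
  [NormedAddCommGroup E] [NormedSpace ℂ E] [FiniteDimensional ℂ E] [NormedAddCommGroup F]
  [NormedSpace ℂ F]

theorem TendstoInMeanSquare.map_linearMap {f : ℕ → Ω → E} {c : E}
    (hf : TendstoInMeanSquare μ f c) (φ : E →ₗ[ℂ] F) :
    TendstoInMeanSquare μ (fun n ω => φ (f n ω)) (φ c) :=
  hf.comp_lipschitzWith (LinearMap.toContinuousLinearMap φ).lipschitz

end LinearMap

section GramMatrix

open scoped Matrix.Norms.Frobenius

variable {Ω J : Type*} [MeasurableSpace Ω] {μ : Measure Ω} [Fintype J]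

theorem matrix_apply_eq_sum [DecidableEq J] (Γ : Matrix J J ℂ) (i j : J) :
    Γ i j = ∑ n : Fin 4, 4⁻¹ * Complex.I ^ (n : ℕ) *
      (((Pi.single i 1 + Complex.I ^ (n : ℕ) • Pi.single j 1) ᵥ* Γ) ⬝ᵥ
        star (Pi.single i 1 + Complex.I ^ (n : ℕ) • Pi.single j 1 : J → ℂ)) := by
  simp only [Matrix.add_vecMul, Matrix.smul_vecMul, Matrix.single_one_vecMul, star_add, star_smul,
    Pi.star_single, star_one, dotProduct_add, dotProduct_smul, dotProduct_single, mul_one,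
    smul_eq_mul, Fin.sum_univ_four]
  simp only [Fin.isValue, Fin.coe_ofNat_eq_mod, Nat.zero_mod, pow_zero, mul_one, one_smul,
    Pi.add_apply, Matrix.row_apply, star_one, one_mul, Nat.one_mod, pow_one, Pi.smul_apply,
    smul_eq_mul, RCLike.star_def, Complex.conj_I, neg_mul, Nat.reduceMod, Complex.I_sq, mul_neg,
    neg_smul, Pi.neg_apply, star_neg, neg_add_rev, neg_neg, Nat.mod_succ, Complex.I_pow_three]
  linear_combination (1 / 2 * (Γ i j - Γ j i)) * Complex.I_sq

theorem tendstoInMeanSquare_matrix [IsFiniteMeasure μ] {g : ℕ → Ω → Matrix J J ℂ}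
    {Γ : Matrix J J ℂ}
    (hg : ∀ z : J → ℂ, TendstoInMeanSquare μ (fun n ω => (z ᵥ* g n ω) ⬝ᵥ star z)
      ((z ᵥ* Γ) ⬝ᵥ star z)) : TendstoInMeanSquare μ g Γ := by
  classical
  have hentry (i j : J) : TendstoInMeanSquare μ (fun n ω => g n ω i j) (Γ i j) := by
    have hpol := (tendstoInMeanSquare_pi fun n : Fin 4 =>
      hg (Pi.single i 1 + Complex.I ^ (n : ℕ) • Pi.single j 1)).map_linearMap
        (∑ n : Fin 4, (4⁻¹ * Complex.I ^ (n : ℕ)) • LinearMap.proj (φ := fun _ => ℂ) n)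
    simpa only [LinearMap.sum_apply, LinearMap.smul_apply, LinearMap.proj_apply, smul_eq_mul,
      ← matrix_apply_eq_sum] using hpol
  exact (tendstoInMeanSquare_pi fun i => tendstoInMeanSquare_pi (hentry i)).map_linearMap
    (Matrix.ofLinearEquiv ℂ).toLinearMap

theorem tendstoInMeanSquare_smul_mul_conjTranspose [IsProbabilityMeasure μ]
    {ι : ℕ → Type*} [∀ n, Fintype (ι n)] {G : ∀ n, Ω → Matrix J (ι n) ℂ}
    {K : ∀ n, (J → ℂ) → Matrix (ι n) (ι n) ℂ}
    {r : ℕ → ℝ} {Γ : Matrix J J ℂ} (hr : ∀ n, 0 ≤ r n)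
    (hG : ∀ n z, IsCircularGaussian μ (fun i ω => (z ᵥ* G n ω) i) (K n z))
    (htrace : ∀ n z, ((r n * (K n z).trace.re : ℝ) : ℂ) = (z ᵥ* Γ) ⬝ᵥ star z)
    (hK : ∀ z, Tendsto (fun n => r n * ‖K n z‖) atTop (𝓝 0)) :
    TendstoInMeanSquare μ (fun n ω => (r n : ℂ) • (G n ω * (G n ω)ᴴ)) Γ := by
  refine tendstoInMeanSquare_matrix fun z => ?_
  have hform (n : ℕ) (ω : Ω) : (z ᵥ* ((r n : ℂ) • (G n ω * (G n ω)ᴴ))) ⬝ᵥ star z =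
      ((r n * ∑ i, ‖(z ᵥ* G n ω) i‖ ^ 2 : ℝ) : ℂ) := by
    rw [Matrix.vecMul_smul, smul_dotProduct, ← sum_norm_sq_vecMul, Complex.ofReal_mul, smul_eq_mul]
  simp only [hform]
  refine ⟨fun n => ((hG n z).memLp_sum_norm_sq.const_mul (r n)).ofReal, ?_⟩
  have hlim : Tendsto (fun n => ENNReal.ofReal (r n * ‖K n z‖)) atTop (𝓝 0) := by
    simpa using ENNReal.tendsto_ofReal (hK z)
  refine tendsto_of_tendsto_of_tendsto_of_le_of_le tendsto_const_nhds hlim (fun _ => zero_le)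
    fun n => ?_
  have hdiff (ω : Ω) : ‖((r n * ∑ i, ‖(z ᵥ* G n ω) i‖ ^ 2 : ℝ) : ℂ) - (z ᵥ* Γ) ⬝ᵥ star z‖ ≤
      r n * ‖∑ i, ‖(z ᵥ* G n ω) i‖ ^ 2 - (K n z).trace.re‖ := by
    rw [← htrace n z, ← Complex.ofReal_sub, Complex.norm_real, ← mul_sub, norm_mul,
      Real.norm_of_nonneg (hr n)]
  calc eLpNorm _ 2 μ
      ≤ ENNReal.ofReal (r n) *
          eLpNorm (fun ω => ∑ i, ‖(z ᵥ* G n ω) i‖ ^ 2 - (K n z).trace.re) 2 μ :=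
        eLpNorm_le_mul_eLpNorm_of_ae_le_mul (ae_of_all _ hdiff) 2
    _ ≤ ENNReal.ofReal (r n) * ENNReal.ofReal ‖K n z‖ := by
        gcongr
        exact (hG n z).eLpNorm_sum_norm_sq_sub_trace_le
    _ = ENNReal.ofReal (r n * ‖K n z‖) := (ENNReal.ofReal_mul (hr n)).symm

end GramMatrix

section LinearEstimation

open scoped Matrix.Norms.Frobenius ComplexOrder

variable {ι κ J : Type*} [Fintype ι] [Fintype κ] [Fintype J]

theorem vecMul_vecMul_dotProduct_star (M : Matrix κ J ℂ) (Γ : Matrix J J ℂ) (w : κ → ℂ)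
    (a : J → ℂ) : ((a ᵥ* Γ) ⬝ᵥ star (w ᵥ* M)) = (a ᵥ* (Γ * Mᴴ)) ⬝ᵥ star w := by
  rw [Matrix.star_vecMul, Matrix.dotProduct_mulVec, Matrix.vecMul_vecMul]

variable [DecidableEq κ]

/-- The mean square error of the LMMSE estimate with pilot vector `x` of the target `t ᵥ* G` from
the observations `M * G`, where `Γ` is the Gram matrix of the rows of `G`. -/
noncomputable def lmmseError (M : Matrix κ J ℂ) (x : κ → ℂ) (t : J → ℂ) (Γ : Matrix J J ℂ) : ℝ :=
  (((star x ᵥ* (M * Γ * Mᴴ)⁻¹ ᵥ* M - t) ᵥ* Γ) ⬝ᵥ star (star x ᵥ* (M * Γ * Mᴴ)⁻¹ ᵥ* M - t)).re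

theorem lmmseError_smul_mul_conjTranspose (M : Matrix κ J ℂ) (x : κ → ℂ) (t : J → ℂ) (r : ℝ)
    (G : Matrix J ι ℂ) :
    lmmseError M x t ((r : ℂ) • (G * Gᴴ)) =
      r * ∑ i, ‖((star x ᵥ* ((r : ℂ) • ((M * G) * (M * G)ᴴ))⁻¹) ᵥ* (M * G) - t ᵥ* G) i‖ ^ 2 := by
  have hcov : M * ((r : ℂ) • (G * Gᴴ)) * Mᴴ = (r : ℂ) • ((M * G) * (M * G)ᴴ) := by
    rw [Matrix.mul_smul, Matrix.smul_mul, Matrix.conjTranspose_mul, ← Matrix.mul_assoc M,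
      Matrix.mul_assoc]
  rw [lmmseError, hcov, Matrix.vecMul_smul, smul_dotProduct, ← sum_norm_sq_vecMul, smul_eq_mul,
    ← Complex.ofReal_mul, Complex.ofReal_re, Matrix.sub_vecMul, Matrix.vecMul_vecMul _ M G]

theorem exists_continuous_lmmseError_eq (M : Matrix κ J ℂ) (x : κ → ℂ) (t : J → ℂ) :
    ∃ φ : ℂ × Matrix J J ℂ → ℝ, Continuous φ ∧
      ∀ Γ, lmmseError M x t Γ = φ ((M * Γ * Mᴴ).det⁻¹, Γ) := by
  refine ⟨fun p => (((star x ᵥ* (p.1 • (M * p.2 * Mᴴ).adjugate) ᵥ* M - t) ᵥ* p.2) ⬝ᵥ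
    star (star x ᵥ* (p.1 • (M * p.2 * Mᴴ).adjugate) ᵥ* M - t)).re, by fun_prop, fun Γ => ?_⟩
  rw [lmmseError, Matrix.inv_def, Ring.inverse_eq_inv']

theorem continuousAt_lmmseError {M : Matrix κ J ℂ} (x : κ → ℂ) (t : J → ℂ) {Γ : Matrix J J ℂ}
    (hdet : (M * Γ * Mᴴ).det ≠ 0) : ContinuousAt (lmmseError M x t) Γ := by
  obtain ⟨φ, hφ, hφ_eq⟩ := exists_continuous_lmmseError_eq M x t
  have hinv : ContinuousAt (fun A : Matrix J J ℂ => (M * A * Mᴴ).det⁻¹) Γ :=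
    ContinuousAt.inv₀ (by fun_prop) hdet
  rw [funext hφ_eq]
  exact hφ.continuousAt.comp (hinv.prodMk continuousAt_id)

theorem aestronglyMeasurable_inv_det {Ω : Type*} [MeasurableSpace Ω] {μ : Measure Ω}
    (M : Matrix κ J ℂ) {g : Ω → Matrix J J ℂ} (hg : AEStronglyMeasurable g μ) :
    AEStronglyMeasurable (fun ω => (M * g ω * Mᴴ).det⁻¹) μ := by
  have hcont : Continuous fun A : Matrix J J ℂ => (M * A * Mᴴ).det := by fun_prop
  exact (hcont.comp_aestronglyMeasurable hg).aemeasurable.inv.aestronglyMeasurable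

theorem aestronglyMeasurable_lmmseError {Ω : Type*} [MeasurableSpace Ω] {μ : Measure Ω}
    (M : Matrix κ J ℂ) (x : κ → ℂ) (t : J → ℂ) {g : Ω → Matrix J J ℂ}
    (hg : AEStronglyMeasurable g μ) :
    AEStronglyMeasurable (fun ω => lmmseError M x t (g ω)) μ := by
  obtain ⟨φ, hφ, hφ_eq⟩ := exists_continuous_lmmseError_eq M x t
  simp only [hφ_eq]
  exact hφ.comp_aestronglyMeasurable ((aestronglyMeasurable_inv_det M hg).prodMk hg)

theorem lmmseError_nonneg (M : Matrix κ J ℂ) (x : κ → ℂ) (t : J → ℂ) {Γ : Matrix J J ℂ}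
    (hΓ : Γ.PosSemidef) : 0 ≤ lmmseError M x t Γ := by
  rw [lmmseError, ← Matrix.dotProduct_mulVec]
  simpa using hΓ.re_dotProduct_nonneg (star (star x ᵥ* (M * Γ * Mᴴ)⁻¹ ᵥ* M - t))

theorem re_sub_vecMul_dotProduct_le {Γ : Matrix J J ℂ} (hΓ : Γ.PosSemidef) (a b : J → ℂ) :
    (((a - b) ᵥ* Γ) ⬝ᵥ star (a - b)).re ≤
      2 * ((a ᵥ* Γ) ⬝ᵥ star a).re + 2 * ((b ᵥ* Γ) ⬝ᵥ star b).re := by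
  have hadd : 0 ≤ (((a + b) ᵥ* Γ) ⬝ᵥ star (a + b)).re := by
    rw [← Matrix.dotProduct_mulVec]
    simpa using hΓ.re_dotProduct_nonneg (star (a + b))
  simp only [Matrix.add_vecMul, Matrix.sub_vecMul, star_add, star_sub, dotProduct_add,
    dotProduct_sub, add_dotProduct, sub_dotProduct, Complex.add_re, Complex.sub_re] at hadd ⊢
  linarith

theorem lmmseError_le (M : Matrix κ J ℂ) (x : κ → ℂ) (t : J → ℂ) {Γ : Matrix J J ℂ}
    (hΓ : Γ.PosSemidef) :
    lmmseError M x t Γ ≤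
      2 * ‖(star x ᵥ* (M * Γ * Mᴴ).adjugate) ⬝ᵥ x‖ * ‖(M * Γ * Mᴴ).det‖⁻¹ +
        2 * ‖(t ᵥ* Γ) ⬝ᵥ star t‖ := by
  set w := star x ᵥ* (M * Γ * Mᴴ)⁻¹ with hw
  have hwx : ‖w ⬝ᵥ x‖ = ‖(star x ᵥ* (M * Γ * Mᴴ).adjugate) ⬝ᵥ x‖ * ‖(M * Γ * Mᴴ).det‖⁻¹ := by
    rw [hw, Matrix.inv_def, Ring.inverse_eq_inv', Matrix.vecMul_smul, smul_dotProduct, smul_eq_mul,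
      norm_mul, norm_inv, mul_comm]
  have hest : (((w ᵥ* M) ᵥ* Γ) ⬝ᵥ star (w ᵥ* M)).re ≤ ‖w ⬝ᵥ x‖ := by
    rw [vecMul_vecMul_dotProduct_star, Matrix.vecMul_vecMul, ← Matrix.mul_assoc]
    by_cases hdet : IsUnit (M * Γ * Mᴴ).det
    · rw [hw, Matrix.vecMul_vecMul, Matrix.nonsing_inv_mul _ hdet, Matrix.vecMul_one, ← hw,
        Matrix.star_dotProduct_star, ← norm_star]
      exact Complex.re_le_norm _
    · simp [hw, Matrix.nonsing_inv_apply_not_isUnit _ hdet]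
  have hsub := re_sub_vecMul_dotProduct_le hΓ (w ᵥ* M) t
  have ht := Complex.re_le_norm ((t ᵥ* Γ) ⬝ᵥ star t)
  rw [hwx] at hest
  rw [lmmseError]
  linarith

theorem lmmseError_eq_sub {M : Matrix κ J ℂ} {x : κ → ℂ} {t : J → ℂ} {Γ : Matrix J J ℂ}
    (hΓ : Γ.IsHermitian) (hx : M *ᵥ (Γ *ᵥ star t) = x) (hdet : IsUnit (M * Γ * Mᴴ).det) :
    lmmseError M x t Γ =
      ((t ᵥ* Γ) ⬝ᵥ star t).re - ((star x ᵥ* (M * Γ * Mᴴ)⁻¹) ⬝ᵥ x).re := by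
  set w := star x ᵥ* (M * Γ * Mᴴ)⁻¹ with hw
  have hest : ((w ᵥ* M) ᵥ* Γ) ⬝ᵥ star (w ᵥ* M) = star (w ⬝ᵥ x) := by
    rw [vecMul_vecMul_dotProduct_star, Matrix.vecMul_vecMul, ← Matrix.mul_assoc, hw,
      Matrix.vecMul_vecMul, Matrix.nonsing_inv_mul _ hdet, Matrix.vecMul_one,
      Matrix.star_dotProduct_star]
  have hcross : ((w ᵥ* M) ᵥ* Γ) ⬝ᵥ star t = w ⬝ᵥ x := by
    rw [← hx, Matrix.dotProduct_mulVec, Matrix.dotProduct_mulVec]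
  have hcross' : (t ᵥ* Γ) ⬝ᵥ star (w ᵥ* M) = star (w ⬝ᵥ x) := by
    rw [← hcross, ← Matrix.star_dotProduct_star, star_star, Matrix.star_vecMul Γ, hΓ.eq,
      ← Matrix.dotProduct_mulVec]
  rw [lmmseError, Matrix.sub_vecMul, star_sub, dotProduct_sub, sub_dotProduct, sub_dotProduct,
    hest, hcross, hcross']
  simp only [RCLike.star_def, Complex.sub_re, Complex.conj_re]
  ring

theorem isLinearMap_adjugate_fin_two (M : Matrix (Fin 2) J ℂ) (x : Fin 2 → ℂ) :
    IsLinearMap ℂ fun Γ : Matrix J J ℂ => 2 * ((star x ᵥ* (M * Γ * Mᴴ).adjugate) ⬝ᵥ x) where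
  map_add A B := by
    have hadd : (M * (A + B) * Mᴴ).adjugate = (M * A * Mᴴ).adjugate + (M * B * Mᴴ).adjugate := by
      rw [Matrix.mul_add, Matrix.add_mul, Matrix.adjugate_fin_two, Matrix.adjugate_fin_two,
        Matrix.adjugate_fin_two]
      ext i j
      fin_cases i <;> fin_cases j <;> simp [add_comm]
    rw [hadd, Matrix.vecMul_add, add_dotProduct, mul_add]
  map_smul c A := by
    rw [Matrix.mul_smul, Matrix.smul_mul, Matrix.adjugate_smul, Fintype.card_fin, pow_one,
      Matrix.vecMul_smul, smul_dotProduct, mul_smul_comm]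

theorem isLinearMap_vecMul_dotProduct (t : J → ℂ) :
    IsLinearMap ℂ fun Γ : Matrix J J ℂ => 2 * ((t ᵥ* Γ) ⬝ᵥ star t) where
  map_add A B := by rw [Matrix.vecMul_add, add_dotProduct, mul_add]
  map_smul c A := by rw [Matrix.vecMul_smul, smul_dotProduct, mul_smul_comm]

theorem integrable_and_tendsto_integral_lmmseError {Ω : Type*} [MeasurableSpace Ω]
    {μ : Measure Ω} [IsProbabilityMeasure μ] {M : Matrix (Fin 2) J ℂ} (x : Fin 2 → ℂ) (t : J → ℂ)
    {g : ℕ → Ω → Matrix J J ℂ} {Γ : Matrix J J ℂ} {b : ℝ≥0}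
    (hg : TendstoInMeanSquare μ g Γ) (hpos : ∀ n ω, (g n ω).PosSemidef)
    (hb : ∀ n, eLpNorm (fun ω => ‖(M * g n ω * Mᴴ).det‖⁻¹) 2 μ ≤ b)
    (hdet : (M * Γ * Mᴴ).det ≠ 0) :
    (∀ n, Integrable (fun ω => lmmseError M x t (g n ω)) μ) ∧
      Tendsto (fun n => ∫ ω, lmmseError M x t (g n ω) ∂μ) atTop (𝓝 (lmmseError M x t Γ)) := by
  have hgm (n : ℕ) := (hg.1 n).aestronglyMeasurable
  have hadj := (hg.map_linearMap (isLinearMap_adjugate_fin_two M x).mk').norm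
  have ht := (hg.map_linearMap (isLinearMap_vecMul_dotProduct t).mk').norm
  refine integrable_and_tendsto_integral_of_le_mul_add
    (fun n => aestronglyMeasurable_lmmseError M x t (hgm n))
    (tendstoInMeasure_comp_continuousAt hg.tendstoInMeasure (continuousAt_lmmseError x t hdet))
    hadj (fun n => ?_) hb ht fun n ω => ?_
  · simpa only [norm_inv] using (aestronglyMeasurable_inv_det M (hgm n)).norm
  · rw [Real.norm_of_nonneg (lmmseError_nonneg M x t (hpos n ω))]
    have hle := lmmseError_le M x t (hpos n ω)
    simpa only [IsLinearMap.mk'_apply, norm_mul, RCLike.norm_ofNat] using hle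

end LinearEstimation

section FrobeniusNorm

open scoped Matrix.Norms.Frobenius

variable {ι κ ι' κ' : Type*} [Fintype ι] [Fintype κ] [Fintype ι'] [Fintype κ']

theorem frobenius_norm_kronecker (A : Matrix ι κ ℂ) (B : Matrix ι' κ' ℂ) :
    ‖A ⊗ₖ B‖ = ‖A‖ * ‖B‖ := by
  rw [← sq_eq_sq₀ (norm_nonneg _) (by positivity), mul_pow, frobenius_norm_sq,
    frobenius_norm_sq, frobenius_norm_sq]
  simp only [Fintype.sum_prod_type, Matrix.kronecker_apply, norm_mul, mul_pow,
    Finset.sum_mul_sum]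

theorem frobenius_norm_one [DecidableEq ι] : ‖(1 : Matrix ι ι ℂ)‖ = √(Fintype.card ι) := by
  rw [← coe_nnnorm, Matrix.frobenius_nnnorm_one, nnnorm_one, mul_one, Real.coe_sqrt,
    NNReal.coe_natCast]

end FrobeniusNorm

theorem dft_mul_conjTranspose {N : ℕ} (hN : N ≠ 0) : dft N * (dft N)ᴴ = 1 := by
  set ζ : ℂ := Complex.exp (2 * Real.pi * Complex.I / N) with hζ
  have hroot : IsPrimitiveRoot ζ N := Complex.isPrimitiveRoot_exp N hN
  have hsqrt : (Real.sqrt N : ℂ) * (Real.sqrt N : ℂ) = N := by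
    rw [← Complex.ofReal_mul, Real.mul_self_sqrt (by positivity), Complex.ofReal_natCast]
  have hterm (p q k : Fin N) :
      dft N p k * star (dft N q k) = (ζ ^ (q : ℕ) / ζ ^ (p : ℕ)) ^ (k : ℕ) / N := by
    simp only [dft, Matrix.of_apply, star_div₀, RCLike.star_def, Complex.conj_ofReal,
      ← Complex.exp_conj, hζ, ← Complex.exp_nat_mul, ← Complex.exp_sub]
    rw [div_mul_div_comm, hsqrt, ← Complex.exp_add]
    congr 2
    simp only [map_neg, map_mul, map_div₀, Complex.conj_I, Complex.conj_ofReal, map_natCast,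
      map_ofNat]
    ring
  ext p q
  simp only [Matrix.mul_apply, Matrix.conjTranspose_apply, hterm]
  rw [← Finset.sum_div, Fin.sum_univ_eq_sum_range (fun k => (ζ ^ (q : ℕ) / ζ ^ (p : ℕ)) ^ k)]
  rcases eq_or_ne p q with rfl | hpq
  · simp [hN, hroot.ne_zero hN]
  · have hne : ζ ^ (q : ℕ) / ζ ^ (p : ℕ) ≠ 1 := by
      rw [Ne, div_eq_one_iff_eq (pow_ne_zero _ (hroot.ne_zero hN))]
      exact fun h => hpq (Fin.ext (hroot.pow_inj q.2 p.2 h).symm)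
    rw [geom_sum_eq hne, div_pow, ← pow_mul, ← pow_mul, mul_comm, pow_mul, mul_comm, pow_mul,
      hroot.pow_eq_one, Matrix.one_apply_ne hpq]
    simp

namespace Setup

variable {N L : ℕ} (S : Setup N L)

theorem Fs_mul_conjTranspose : S.Fs * S.Fsᴴ = 1 := by
  rcases S.P.eq_empty_or_nonempty with hP | ⟨p, -⟩
  · ext p
    simpa [hP] using p.2
  · change (dft N).submatrix Subtype.val id * ((dft N).submatrix Subtype.val id)ᴴ = 1
    rw [Matrix.conjTranspose_submatrix, ← Matrix.submatrix_mul _ _ _ _ _ Function.bijective_id,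
      dft_mul_conjTranspose p.pos.ne', Matrix.submatrix_one _ Subtype.val_injective]

theorem norm_FLs (hL : L ≤ N) (p : S.P) (l : Fin L) : ‖S.FLs hL p l‖ = 1 := by
  have hN : (Real.sqrt N : ℂ) ≠ 0 := by
    simpa using p.1.pos.ne'
  have hexp := Complex.norm_exp_ofReal_mul_I (-(2 * Real.pi * p.1 * (Fin.castLE hL l : ℕ) / N))
  rw [FLs, Matrix.of_apply, dft, Matrix.of_apply, mul_div_cancel₀ _ hN]
  convert! hexp using 3
  push_cast
  ring

theorem FLs_mul_star (hL : L ≤ N) (p : S.P) (l : Fin L) :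
    S.FLs hL p l * star (S.FLs hL p l) = 1 := by
  rw [RCLike.star_def, Complex.mul_conj', norm_FLs, Complex.ofReal_one, one_pow]

theorem trace_RF (hL : L ≤ N) : (S.RF hL).trace = L * S.s := by
  simp only [RF, Matrix.trace, Matrix.diag, Matrix.mul_apply, Matrix.transpose_apply,
    Matrix.map_apply, FLs_mul_star]
  simp [s]

theorem trace_FLs_mul_conjTranspose (hL : L ≤ N) :
    (S.FLs hL * (S.FLs hL)ᴴ).trace = L * S.s := by
  simp only [Matrix.trace, Matrix.diag, Matrix.mul_apply, Matrix.conjTranspose_apply,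
    FLs_mul_star]
  simp [s, mul_comm]

theorem trace_R (hΔ : 0 < S.Δ) (NT : ℕ) (u : Fin 2) : (S.R NT u).trace = NT / L := by
  have hdiag (m : Fin NT) : S.R NT u m m = (L : ℂ)⁻¹ := by
    have hΔ' : (S.Δ : ℂ) ≠ 0 := by exact_mod_cast hΔ.ne'
    simp only [R, Matrix.of_apply, sub_self, mul_zero, zero_mul, neg_zero, Complex.exp_zero,
      intervalIntegral.integral_const, Complex.real_smul]
    push_cast
    field_simp
    ring
  simp [Matrix.trace, hdiag, div_eq_mul_inv]

theorem T_eq_one (hL0 : 0 < L) (hL : L ≤ N) (hP : S.P.Nonempty) (hΔ : 0 < S.Δ) {NT : ℕ}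
    (hNT : 0 < NT) (u : Fin 2) : S.T hL NT u = 1 := by
  have hL' : (L : ℂ) ≠ 0 := by exact_mod_cast hL0.ne'
  have hNT' : (NT : ℂ) ≠ 0 := by exact_mod_cast hNT.ne'
  have hs : (S.s : ℂ) ≠ 0 := by exact_mod_cast hP.card_pos.ne'
  rw [T, trace_RF, S.trace_R hΔ]
  field_simp

section RowCovariance

variable {NT : ℕ}

/-- The matrix whose rows are the two channel rows followed by the two noise rows. -/
noncomputable def signal (hL : L ≤ N) (h : Fin 2 → Fin NT × Fin L → ℂ)
    (w : Fin NT × Fin 2 × Fin N → ℂ) : Matrix (Fin 2 ⊕ Fin 2) (Fin NT × S.P) ℂ :=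
  Matrix.fromRows (S.H hL h) (S.noise w)

/-- The matrix `[X I]` that forms the observations from the channel and noise rows. -/
noncomputable def mixing : Matrix (Fin 2) (Fin 2 ⊕ Fin 2) ℂ := Matrix.fromCols S.X 1

theorem mixing_mul_signal (hL : L ≤ N) (h : Fin 2 → Fin NT × Fin L → ℂ)
    (w : Fin NT × Fin 2 × Fin N → ℂ) : S.mixing * S.signal hL h w = S.Y hL h w := by
  rw [mixing, signal, Matrix.fromCols_mul_fromRows, Matrix.one_mul, Y]

/-- The covariance matrix of the combination of the channel and noise rows with coefficients
`z`. -/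
noncomputable def rowCov (hL : L ≤ N) (NT : ℕ) (σ2 : ℝ) (z : Fin 2 ⊕ Fin 2 → ℂ) :
    Matrix (Fin NT × S.P) (Fin NT × S.P) ℂ :=
  ∑ u, (z (.inl u) * star (z (.inl u))) • S.R NT u ⊗ₖ (S.FLs hL * (S.FLs hL)ᴴ) +
    ((σ2 : ℂ) * ∑ k, z (.inr k) * star (z (.inr k))) • 1

/-- The large-array limit of the normalised Gram matrix of the channel and noise rows. -/
noncomputable def limitGram (σ2 : ℝ) : Matrix (Fin 2 ⊕ Fin 2) (Fin 2 ⊕ Fin 2) ℂ :=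
  Matrix.fromBlocks 1 0 0 ((σ2 : ℂ) • 1)

theorem isHermitian_limitGram (σ2 : ℝ) : (limitGram σ2).IsHermitian := by
  refine Matrix.isHermitian_one.fromBlocks Matrix.conjTranspose_zero ?_
  simp [Matrix.IsHermitian]

theorem vecMul_limitGram_dotProduct_star (σ2 : ℝ) (z : Fin 2 ⊕ Fin 2 → ℂ) :
    (z ᵥ* limitGram σ2) ⬝ᵥ star z =
      ∑ u, z (.inl u) * star (z (.inl u)) + (σ2 : ℂ) * ∑ k, z (.inr k) * star (z (.inr k)) := by
  rw [limitGram, Matrix.vecMul_fromBlocks, dotProduct, Fintype.sum_sum_type]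
  simp only [Sum.elim_inl, Sum.elim_inr, Matrix.vecMul_one, Matrix.vecMul_zero, Matrix.vecMul_smul,
    add_zero, zero_add, Pi.smul_apply, Pi.star_apply, Function.comp_apply, smul_eq_mul, mul_assoc,
    Finset.mul_sum]

theorem trace_rowCov (hL0 : 0 < L) (hL : L ≤ N) (hΔ : 0 < S.Δ) (NT : ℕ) (σ2 : ℝ)
    (z : Fin 2 ⊕ Fin 2 → ℂ) :
    (S.rowCov hL NT σ2 z).trace = (NT * S.s) * ((z ᵥ* limitGram σ2) ⬝ᵥ star z) := by
  have hL' : (L : ℂ) ≠ 0 := by exact_mod_cast hL0.ne'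
  simp only [rowCov, Matrix.trace_add, Matrix.trace_sum, Matrix.trace_smul,
    Matrix.trace_kronecker, S.trace_R hΔ, trace_FLs_mul_conjTranspose, Matrix.trace_one,
    Fintype.card_prod, Fintype.card_fin, Fintype.card_coe, smul_eq_mul, ← Finset.sum_mul,
    vecMul_limitGram_dotProduct_star, s]
  push_cast
  field_simp

open scoped Matrix.Norms.Frobenius

theorem tendsto_norm_R_div (hD : 0 < S.D) (hΔ : 0 < S.Δ) (u : Fin 2) :
    Tendsto (fun n : ℕ => ‖S.R n u‖ / n) atTop (𝓝 0) := by
  have hmean := (tendsto_mean_norm_integral_exp_sin_sq hD.ne'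
    (by linarith : S.θ u - S.Δ ≤ S.θ u + S.Δ)).const_mul (‖(1 / (2 * S.Δ * L) : ℂ)‖ ^ 2)
  rw [mul_zero] at hmean
  have hsq (n : ℕ) : (‖S.R n u‖ / n) ^ 2 = ‖(1 / (2 * S.Δ * L) : ℂ)‖ ^ 2 *
      ((∑ m : Fin n, ∑ k : Fin n, ‖∫ t in (S.θ u - S.Δ)..(S.θ u + S.Δ), Complex.exp
        (-(2 * Real.pi * Complex.I * S.D * ((m : ℂ) - (k : ℂ)) * Real.sin t))‖ ^ 2) / n ^ 2) := by
    rw [div_pow, frobenius_norm_sq]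
    simp only [R, Matrix.of_apply, norm_mul, mul_pow, ← Finset.mul_sum, mul_div_assoc]
  have hsqrt := hmean.sqrt
  simp only [← hsq, Real.sqrt_sq (div_nonneg (norm_nonneg _) (Nat.cast_nonneg _)),
    Real.sqrt_zero] at hsqrt
  exact hsqrt

theorem tendsto_norm_one_div :
    Tendsto (fun n : ℕ => ‖(1 : Matrix (Fin n × S.P) (Fin n × S.P) ℂ)‖ / n) atTop (𝓝 0) := by
  have hnorm (n : ℕ) : ‖(1 : Matrix (Fin n × S.P) (Fin n × S.P) ℂ)‖ / n = √S.s / √n := by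
    rw [frobenius_norm_one, Fintype.card_prod, Fintype.card_fin, Fintype.card_coe, Nat.cast_mul,
      Real.sqrt_mul n.cast_nonneg, mul_div_right_comm, Real.sqrt_div_self', one_div_mul_eq_div, s]
  simp only [hnorm]
  exact (Real.tendsto_sqrt_atTop.comp tendsto_natCast_atTop_atTop).const_div_atTop _

theorem norm_rowCov_le (hL : L ≤ N) (NT : ℕ) (σ2 : ℝ) (z : Fin 2 ⊕ Fin 2 → ℂ) :
    ‖S.rowCov hL NT σ2 z‖ ≤
      ∑ u, ‖z (.inl u)‖ ^ 2 * ‖S.FLs hL * (S.FLs hL)ᴴ‖ * ‖S.R NT u‖ +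
        ‖(σ2 : ℂ) * ∑ k, z (.inr k) * star (z (.inr k))‖ *
          ‖(1 : Matrix (Fin NT × S.P) (Fin NT × S.P) ℂ)‖ := by
  refine (norm_add_le _ _).trans (add_le_add ((norm_sum_le _ _).trans_eq ?_) (norm_smul _ _).le)
  refine Finset.sum_congr rfl fun u _ => ?_
  rw [norm_smul, norm_mul, norm_star, frobenius_norm_kronecker]
  ring

theorem tendsto_norm_rowCov_div (hD : 0 < S.D) (hΔ : 0 < S.Δ) (hL : L ≤ N) (σ2 : ℝ)
    (z : Fin 2 ⊕ Fin 2 → ℂ) :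
    Tendsto (fun n : ℕ => ‖S.rowCov hL n σ2 z‖ / n) atTop (𝓝 0) := by
  have hchannel := tendsto_finsetSum Finset.univ fun u _ => (S.tendsto_norm_R_div hD hΔ u).const_mul
    (‖z (.inl u)‖ ^ 2 * ‖S.FLs hL * (S.FLs hL)ᴴ‖)
  have hnoise := S.tendsto_norm_one_div.const_mul
    ‖(σ2 : ℂ) * ∑ k, z (.inr k) * star (z (.inr k))‖
  have hbound := hchannel.add hnoise
  simp only [mul_zero, Finset.sum_const_zero, add_zero] at hbound
  refine squeeze_zero (fun n => by positivity) (fun n => ?_) hbound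
  refine (div_le_div_of_nonneg_right (S.norm_rowCov_le hL n σ2 z) n.cast_nonneg).trans_eq ?_
  rw [add_div, Finset.sum_div]
  simp only [mul_div_assoc]

end RowCovariance

end Setup

theorem IsCircularGaussian.re_vecMul_dotProduct_star_nonneg {Ω ι : Type*} [MeasurableSpace Ω]
    {μ : Measure Ω} [Fintype ι] {f : ι → Ω → ℂ} {Γ : Matrix ι ι ℂ} (hf : IsCircularGaussian μ f Γ)
    (a : ι → ℂ) : 0 ≤ ((a ᵥ* Γ) ⬝ᵥ star a).re := by
  obtain ⟨v, hv, -⟩ := isCircularGaussian_iff.1 hf a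
  rw [← hv, Complex.ofReal_re]
  exact v.coe_nonneg

namespace Setup

variable {N L : ℕ} (S : Setup N L) {NT : ℕ}

section Model

theorem vecMul_H (hL : L ≤ N) (h : Fin 2 → Fin NT × Fin L → ℂ) (a : Fin 2 → ℂ) :
    a ᵥ* S.H hL h =
      ∑ u, (a u • (1 : Matrix (Fin NT) (Fin NT) ℂ) ⊗ₖ S.FLs hL) *ᵥ h u := by
  ext ip
  simp [H, Matrix.mulVec, Matrix.vecMul, dotProduct, Matrix.one_apply, Fintype.sum_prod_type,
    Finset.mul_sum, mul_assoc]

theorem vecMul_noise (w : Fin NT × Fin 2 × Fin N → ℂ) (c : Fin 2 → ℂ) :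
    c ᵥ* S.noise w = ((1 : Matrix (Fin NT) (Fin NT) ℂ) ⊗ₖ
      Matrix.of fun (p : S.P) (kq : Fin 2 × Fin N) => c kq.1 * S.Fs p kq.2) *ᵥ w := by
  ext ip
  simp [noise, Matrix.mulVec, Matrix.vecMul, dotProduct, Matrix.one_apply, Fintype.sum_prod_type,
    Finset.mul_sum, mul_assoc]

theorem vecMul_signal (hL : L ≤ N) (h : Fin 2 → Fin NT × Fin L → ℂ)
    (w : Fin NT × Fin 2 × Fin N → ℂ) (z : Fin 2 ⊕ Fin 2 → ℂ) :
    z ᵥ* S.signal hL h w = (z ∘ Sum.inl) ᵥ* S.H hL h + (z ∘ Sum.inr) ᵥ* S.noise w :=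
  Matrix.vecMul_fromRows _ _ _

theorem of_mul_Fs_mul_conjTranspose (c : Fin 2 → ℂ) :
    (Matrix.of fun (p : S.P) (kq : Fin 2 × Fin N) => c kq.1 * S.Fs p kq.2) *
      (Matrix.of fun (p : S.P) (kq : Fin 2 × Fin N) => c kq.1 * S.Fs p kq.2)ᴴ =
      (∑ k, c k * star (c k)) • (1 : Matrix S.P S.P ℂ) := by
  rw [← Fs_mul_conjTranspose]
  ext p q
  simp only [Matrix.mul_apply, Matrix.conjTranspose_apply, Matrix.of_apply, Matrix.smul_apply,
    smul_eq_mul, Fintype.sum_prod_type, Finset.sum_mul_sum, star_mul', mul_mul_mul_comm]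

variable {S} {Ω : Type*} [MeasurableSpace Ω] {μ : Measure Ω} {σ2 : ℝ}
  {h : Fin 2 → Fin NT × Fin L → Ω → ℂ} {w : Fin NT × Fin 2 × Fin N → Ω → ℂ}

theorem IsModel.isCircularGaussian_smul_H (hm : S.IsModel μ NT σ2 h w) (hL : L ≤ N) (u : Fin 2)
    (b : ℂ) :
    IsCircularGaussian μ
      (fun x ω => ((b • (1 : Matrix (Fin NT) (Fin NT) ℂ) ⊗ₖ S.FLs hL) *ᵥ fun y => h u y ω) x)
      ((b * star b) • S.R NT u ⊗ₖ (S.FLs hL * (S.FLs hL)ᴴ)) := by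
  convert! (hm.channel u).mulVec (b • (1 : Matrix (Fin NT) (Fin NT) ℂ) ⊗ₖ S.FLs hL) using 1
  rw [Matrix.conjTranspose_smul, Matrix.conjTranspose_kronecker, Matrix.conjTranspose_one,
    Matrix.smul_mul, Matrix.smul_mul, Matrix.mul_smul, smul_smul, ← Matrix.mul_kronecker_mul,
    ← Matrix.mul_kronecker_mul, Matrix.one_mul, Matrix.mul_one, Matrix.mul_one]

theorem IsModel.isCircularGaussian_vecMul_H (hm : S.IsModel μ NT σ2 h w)
    (hL : L ≤ N) (a : Fin 2 → ℂ) :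
    IsCircularGaussian μ (fun x ω => (a ᵥ* S.H hL fun v y => h v y ω) x)
      (∑ u, (a u * star (a u)) • S.R NT u ⊗ₖ (S.FLs hL * (S.FLs hL)ᴴ)) := by
  have hmeas (u : Fin 2) :
      Measurable ((a u • (1 : Matrix (Fin NT) (Fin NT) ℂ) ⊗ₖ S.FLs hL) *ᵥ ·) := by
    fun_prop
  have hadd := (hm.isCircularGaussian_smul_H hL 0 (a 0)).add_of_indepFun
    (hm.isCircularGaussian_smul_H hL 1 (a 1)) (hm.indep_channels.comp (hmeas 0) (hmeas 1))
  simpa only [vecMul_H, Fin.sum_univ_two, Pi.add_apply] using hadd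

theorem IsModel.isCircularGaussian_vecMul_noise (hm : S.IsModel μ NT σ2 h w) (c : Fin 2 → ℂ) :
    IsCircularGaussian μ (fun x ω => (c ᵥ* S.noise fun y => w y ω) x)
      (((σ2 : ℂ) * ∑ k, c k * star (c k)) • 1) := by
  simp only [vecMul_noise]
  convert! hm.noise.mulVec ((1 : Matrix (Fin NT) (Fin NT) ℂ) ⊗ₖ
    Matrix.of fun (p : S.P) (kq : Fin 2 × Fin N) => c kq.1 * S.Fs p kq.2) using 1
  rw [Matrix.conjTranspose_kronecker, Matrix.conjTranspose_one, Matrix.mul_smul, Matrix.mul_one,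
    Matrix.smul_mul, ← Matrix.mul_kronecker_mul, Matrix.mul_one, of_mul_Fs_mul_conjTranspose,
    Matrix.kronecker_smul, Matrix.one_kronecker_one, mul_smul]

theorem IsModel.isCircularGaussian_vecMul_signal
    (hm : S.IsModel μ NT σ2 h w) (hL : L ≤ N) (z : Fin 2 ⊕ Fin 2 → ℂ) :
    IsCircularGaussian μ
      (fun x ω => (z ᵥ* S.signal hL (fun v y => h v y ω) fun y => w y ω) x)
      (S.rowCov hL NT σ2 z) := by
  have hH : Measurable fun g : Fin 2 → Fin NT × Fin L → ℂ => (z ∘ Sum.inl) ᵥ* S.H hL g := by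
    simp only [vecMul_H]
    fun_prop
  have hnoise : Measurable fun g : Fin NT × Fin 2 × Fin N → ℂ => (z ∘ Sum.inr) ᵥ* S.noise g := by
    simp only [vecMul_noise]
    fun_prop
  simp only [vecMul_signal]
  exact (hm.isCircularGaussian_vecMul_H hL _).add_of_indepFun
    (hm.isCircularGaussian_vecMul_noise _) (hm.indep_noise.comp hH hnoise)

theorem IsModel.le_re_rowCov (hm : S.IsModel μ NT σ2 h w) (hL : L ≤ N)
    (z : Fin 2 ⊕ Fin 2 → ℂ) (a : Fin NT × S.P → ℂ) :
    σ2 * (∑ k, ‖z (.inr k)‖ ^ 2) * ∑ x, ‖a x‖ ^ 2 ≤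
      ((a ᵥ* S.rowCov hL NT σ2 z) ⬝ᵥ star a).re := by
  have hchannel :=
    (hm.isCircularGaussian_vecMul_H hL (z ∘ Sum.inl)).re_vecMul_dotProduct_star_nonneg a
  simp only [Function.comp_apply] at hchannel
  rw [rowCov, Matrix.vecMul_add, add_dotProduct, Complex.add_re]
  refine le_add_of_nonneg_of_le hchannel (le_of_eq ?_)
  have hstar (c : ℂ) : c * star c = ((‖c‖ ^ 2 : ℝ) : ℂ) := by
    rw [RCLike.star_def, Complex.mul_conj', Complex.ofReal_pow]
  rw [Matrix.vecMul_smul, Matrix.vecMul_one, smul_dotProduct, dotProduct]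
  simp only [Pi.star_apply, hstar, ← Complex.ofReal_sum, ← Complex.ofReal_mul, smul_eq_mul,
    Complex.ofReal_re]

end Model

variable {N L : ℕ} (S : Setup N L)

section GramMatrix

open scoped Matrix.Norms.Frobenius ComplexOrder

/-- The normalised Gram matrix of the channel and noise rows. -/
noncomputable def gram {NT : ℕ} (hL : L ≤ N) (h : Fin 2 → Fin NT × Fin L → ℂ)
    (w : Fin NT × Fin 2 × Fin N → ℂ) : Matrix (Fin 2 ⊕ Fin 2) (Fin 2 ⊕ Fin 2) ℂ :=
  ((((NT : ℝ) * S.s)⁻¹ : ℝ) : ℂ) • (S.signal hL h w * (S.signal hL h w)ᴴ)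

variable {NT : ℕ}

theorem posSemidef_gram (hL : L ≤ N) (h : Fin 2 → Fin NT × Fin L → ℂ)
    (w : Fin NT × Fin 2 × Fin N → ℂ) : (S.gram hL h w).PosSemidef :=
  (Matrix.posSemidef_self_mul_conjTranspose _).smul
    (Complex.zero_le_real.2 (by positivity))

theorem C_eq_smul (hL : L ≤ N) (h : Fin 2 → Fin NT × Fin L → ℂ)
    (w : Fin NT × Fin 2 × Fin N → ℂ) :
    S.C hL h w = ((((NT : ℝ) * S.s)⁻¹ : ℝ) : ℂ) • (S.Y hL h w * (S.Y hL h w)ᴴ) := by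
  rw [C, one_div, Complex.ofReal_inv, Complex.ofReal_mul, Complex.ofReal_natCast,
    Complex.ofReal_natCast]

theorem mixing_mul_gram_mul_conjTranspose (hL : L ≤ N) (h : Fin 2 → Fin NT × Fin L → ℂ)
    (w : Fin NT × Fin 2 × Fin N → ℂ) :
    S.mixing * S.gram hL h w * S.mixingᴴ = S.C hL h w := by
  rw [C_eq_smul, ← mixing_mul_signal, gram, Matrix.mul_smul, Matrix.smul_mul,
    Matrix.conjTranspose_mul, Matrix.mul_assoc, Matrix.mul_assoc, Matrix.mul_assoc]

theorem sqError_div_eq_lmmseError (hL0 : 0 < L) (hL : L ≤ N) (hP : S.P.Nonempty) (hΔ : 0 < S.Δ)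
    (hNT : 0 < NT) (u : Fin 2) (h : Fin 2 → Fin NT × Fin L → ℂ)
    (w : Fin NT × Fin 2 × Fin N → ℂ) :
    S.sqError hL u h w / ((NT : ℝ) * S.s) =
      lmmseError S.mixing (S.pilot u) (Pi.single (.inl u) 1) (S.gram hL h w) := by
  have htarget : Pi.single (.inl u) 1 ᵥ* S.signal hL h w = S.H hL h u := by
    rw [Matrix.single_one_vecMul]
    rfl
  rw [gram, lmmseError_smul_mul_conjTranspose, mixing_mul_signal, ← C_eq_smul, htarget, sqError,
    div_eq_inv_mul]
  simp only [estimate, W, S.T_eq_one hL0 hL hP hΔ hNT, one_smul, Pi.sub_apply]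

variable {S} {Ω : Type*} [MeasurableSpace Ω] {μ : Measure Ω} {σ2 : ℝ}

theorem tendstoInMeanSquare_gram [IsProbabilityMeasure μ] (hL0 : 0 < L) (hL : L ≤ N)
    (hP : S.P.Nonempty) (hD : 0 < S.D) (hΔ : 0 < S.Δ) {d : ℕ → ℕ} (hd : Tendsto d atTop atTop)
    (hd0 : ∀ n, 0 < d n) {h : ∀ n, Fin 2 → Fin (d n) × Fin L → Ω → ℂ}
    {w : ∀ n, Fin (d n) × Fin 2 × Fin N → Ω → ℂ} (hm : ∀ n, S.IsModel μ (d n) σ2 (h n) (w n)) :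
    TendstoInMeanSquare μ (fun n ω => S.gram hL (fun v y => h n v y ω) fun y => w n y ω)
      (limitGram σ2) := by
  have hs : (0 : ℝ) < S.s := by exact_mod_cast hP.card_pos
  refine tendstoInMeanSquare_smul_mul_conjTranspose (fun n => by positivity)
    (fun n => (hm n).isCircularGaussian_vecMul_signal hL) (fun n z => ?_) fun z => ?_
  · have hne : (d n : ℝ) * S.s ≠ 0 := by
      have := hd0 n
      positivity
    have hreal : ((z ᵥ* limitGram σ2) ⬝ᵥ star z).im = 0 := by
      simpa only [star_star, Matrix.dotProduct_mulVec, RCLike.im_to_complex] using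
        (isHermitian_limitGram σ2).im_star_dotProduct_mulVec_self (star z)
    rw [trace_rowCov S hL0 hL hΔ, ← Complex.conj_eq_iff_re.1 (Complex.conj_eq_iff_im.2 hreal)]
    norm_cast
    rw [inv_mul_cancel_left₀ (by exact_mod_cast hne)]
  · have hlim := ((S.tendsto_norm_rowCov_div hD hΔ hL σ2 z).comp hd).div_const (S.s : ℝ)
    rw [zero_div] at hlim
    refine hlim.congr fun n => ?_
    rw [Function.comp_apply, div_div, div_eq_inv_mul]

theorem IsModel.eLpNorm_inv_det_C_le [IsProbabilityMeasure μ]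
    {h : Fin 2 → Fin NT × Fin L → Ω → ℂ} {w : Fin NT × Fin 2 × Fin N → Ω → ℂ}
    (hm : S.IsModel μ NT σ2 h w) (hL : L ≤ N) (hσ : 0 < σ2) (hcard : 5 ≤ NT * S.s) :
    eLpNorm (fun ω => ‖(S.C hL (fun v y => h v y ω) fun y => w y ω).det‖⁻¹) 2 μ ≤
      invDetBound (Fin 2) σ2 ^ (1 / 2 : ℝ) := by
  have hrow (z : Fin 2 → ℂ) := hm.isCircularGaussian_vecMul_signal hL (z ᵥ* S.mixing)
  have hinr (z : Fin 2 → ℂ) (k : Fin 2) : (z ᵥ* S.mixing) (.inr k) = z k := by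
    simp [mixing]
  simp only [Matrix.vecMul_vecMul, mixing_mul_signal] at hrow
  have hbound := lintegral_inv_norm_det_sq_le hσ.le hrow
    (fun z a => by simpa only [hinr] using hm.le_re_rowCov hL (z ᵥ* S.mixing) a)
    (by simpa [s] using hcard)
  rw [eLpNorm_eq_lintegral_rpow_enorm_toReal two_ne_zero (by simp), ENNReal.toReal_ofNat]
  refine ENNReal.rpow_le_rpow ((lintegral_congr fun ω => ?_).trans_le hbound) (by norm_num)
  rw [Real.enorm_eq_ofReal (by positivity), ENNReal.rpow_two, C, one_div, Fintype.card_prod,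
    Fintype.card_fin, Fintype.card_coe, Nat.cast_mul, s]

end GramMatrix

section LimitError

/-- The large-array limit `X Xᴴ + σ² I` of the sample covariance matrix. -/
noncomputable def limitCov (σ2 : ℝ) : Matrix (Fin 2) (Fin 2) ℂ :=
  S.X * S.Xᴴ + (σ2 : ℂ) • 1

theorem mixing_mul_limitGram (σ2 : ℝ) :
    S.mixing * limitGram σ2 = Matrix.fromCols S.X ((σ2 : ℂ) • 1) := by
  rw [mixing, limitGram, Matrix.fromCols_mul_fromBlocks]
  simp

theorem mixing_mul_limitGram_mul_conjTranspose (σ2 : ℝ) :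
    S.mixing * limitGram σ2 * S.mixingᴴ = S.limitCov σ2 := by
  rw [mixing_mul_limitGram, mixing, Matrix.conjTranspose_fromCols_eq_fromRows_conjTranspose,
    Matrix.fromCols_mul_fromRows, Matrix.conjTranspose_one, Matrix.mul_one, limitCov]

theorem X_mul_star (hρ : ∀ u, 0 < S.ρ u) (k u : Fin 2) : S.X k u * star (S.X k u) = S.ρ u := by
  have hexp := Complex.norm_exp_ofReal_mul_I (S.φ u k)
  rw [RCLike.star_def, Complex.mul_conj', X, Matrix.of_apply, norm_mul, mul_comm Complex.I, hexp,
    mul_one, Complex.norm_real, Real.norm_eq_abs, ← Complex.ofReal_pow, sq_abs,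
    Real.sq_sqrt (hρ u).le]

theorem det_limitCov (hρ : ∀ u, 0 < S.ρ u) (σ2 : ℝ) :
    (S.limitCov σ2).det =
      ((‖S.X.det‖ ^ 2 + 2 * (S.ρ 0 + S.ρ 1) * σ2 + σ2 ^ 2 : ℝ) : ℂ) := by
  push_cast
  rw [← Complex.mul_conj', ← RCLike.star_def, Matrix.det_fin_two, Matrix.det_fin_two]
  simp only [limitCov, Matrix.add_apply, Matrix.mul_apply, Matrix.conjTranspose_apply,
    Fin.sum_univ_two, Matrix.smul_apply, Matrix.one_apply_eq, Matrix.one_apply_ne zero_ne_one,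
    Matrix.one_apply_ne one_ne_zero, star_sub, star_mul', smul_eq_mul, mul_one, mul_zero, add_zero]
  linear_combination (σ2 : ℂ) * (S.X_mul_star hρ 0 0 + S.X_mul_star hρ 1 0 +
    S.X_mul_star hρ 0 1 + S.X_mul_star hρ 1 1)

theorem star_pilot_adjugate_limitCov (hρ : ∀ u, 0 < S.ρ u) (σ2 : ℝ) (u : Fin 2) :
    (star (S.pilot u) ᵥ* (S.limitCov σ2).adjugate) ⬝ᵥ S.pilot u =
      ((‖S.X.det‖ ^ 2 + 2 * S.ρ u * σ2 : ℝ) : ℂ) := by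
  have h0 := S.X_mul_star hρ 0 u
  have h1 := S.X_mul_star hρ 1 u
  push_cast
  rw [← Complex.mul_conj', ← RCLike.star_def, Matrix.det_fin_two, Matrix.adjugate_fin_two]
  simp only [Matrix.vecMul, dotProduct, Fin.sum_univ_two, Pi.star_apply, pilot, limitCov,
    Matrix.add_apply, Matrix.mul_apply, Matrix.conjTranspose_apply, Matrix.smul_apply,
    Matrix.one_apply_eq, Matrix.one_apply_ne zero_ne_one, Matrix.one_apply_ne one_ne_zero,
    star_sub, star_mul', Matrix.of_apply, Matrix.cons_val', Matrix.cons_val_zero,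
    Matrix.cons_val_one, Matrix.cons_val_fin_one, smul_eq_mul, mul_one, mul_zero, add_zero]
  obtain rfl | rfl : u = 0 ∨ u = 1 := by omega
  all_goals linear_combination (σ2 : ℂ) * (h0 + h1)

/-- The large-array limit of the normalised mean square error. -/
noncomputable def limitError (u : Fin 2) (σ2 : ℝ) : ℝ :=
  1 - (‖S.X.det‖ ^ 2 + 2 * S.ρ u * σ2) / (‖S.X.det‖ ^ 2 + 2 * (S.ρ 0 + S.ρ 1) * σ2 + σ2 ^ 2)

theorem det_limitCov_ne_zero (hρ : ∀ u, 0 < S.ρ u) {σ2 : ℝ} (hσ : 0 < σ2) :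
    (S.limitCov σ2).det ≠ 0 := by
  have hρ0 := hρ 0
  have hρ1 := hρ 1
  rw [det_limitCov S hρ, Complex.ofReal_ne_zero]
  positivity

theorem lmmseError_limitGram (hρ : ∀ u, 0 < S.ρ u) {σ2 : ℝ} (hσ : 0 < σ2) (u : Fin 2) :
    lmmseError S.mixing (S.pilot u) (Pi.single (.inl u) 1) (limitGram σ2) = S.limitError u σ2 := by
  have hpilot : S.mixing *ᵥ (limitGram σ2 *ᵥ star (Pi.single (.inl u) 1)) = S.pilot u := by
    rw [Matrix.mulVec_mulVec, mixing_mul_limitGram, Pi.star_single, star_one,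
      Matrix.mulVec_single_one]
    rfl
  have hdet : IsUnit (S.mixing * limitGram σ2 * S.mixingᴴ).det := by
    rw [mixing_mul_limitGram_mul_conjTranspose]
    exact (S.det_limitCov_ne_zero hρ hσ).isUnit
  rw [lmmseError_eq_sub (isHermitian_limitGram σ2) hpilot hdet,
    mixing_mul_limitGram_mul_conjTranspose, Matrix.inv_def, Ring.inverse_eq_inv',
    Matrix.vecMul_smul, smul_dotProduct, star_pilot_adjugate_limitCov S hρ, det_limitCov S hρ,
    vecMul_limitGram_dotProduct_star, smul_eq_mul, ← Complex.ofReal_inv, ← Complex.ofReal_mul,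
    Complex.ofReal_re, limitError, inv_mul_eq_div]
  simp [Pi.single_apply]

theorem tendsto_limitError_of_det_ne_zero (hdet : S.X.det ≠ 0) (u : Fin 2) :
    Tendsto (S.limitError u) (𝓝[>] 0) (𝓝 0) := by
  have hcont : ContinuousAt (S.limitError u) 0 := by
    unfold limitError
    refine continuousAt_const.sub (ContinuousAt.div (by fun_prop) (by fun_prop) ?_)
    simpa using hdet
  have hzero : S.limitError u 0 = 0 := by
    simp [limitError, hdet]
  simpa only [hzero] using hcont.tendsto.mono_left (nhdsWithin_le_nhds (s := Set.Ioi 0))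

theorem tendsto_limitError_of_det_eq_zero (hρ : ∀ u, 0 < S.ρ u) (hdet : S.X.det = 0)
    (u : Fin 2) :
    Tendsto (S.limitError u) (𝓝[>] 0) (𝓝 (1 - S.ρ u / (S.ρ 0 + S.ρ 1))) := by
  have hsum : 0 < S.ρ 0 + S.ρ 1 := add_pos (hρ 0) (hρ 1)
  have hcont : ContinuousAt (fun t : ℝ => 1 - 2 * S.ρ u / (2 * (S.ρ 0 + S.ρ 1) + t)) 0 := by
    refine continuousAt_const.sub (ContinuousAt.div (by fun_prop) (by fun_prop) ?_)
    positivity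
  have hlim := hcont.tendsto.mono_left (nhdsWithin_le_nhds (s := Set.Ioi 0))
  rw [add_zero, mul_div_mul_left _ _ two_ne_zero] at hlim
  refine hlim.congr' ?_
  filter_upwards [self_mem_nhdsWithin] with t (ht : 0 < t)
  rw [limitError, hdet, norm_zero]
  field_simp
  ring

theorem exists_tendsto_limitError (hρ : ∀ u, 0 < S.ρ u)
    (hX : IsUnit S.X.det ∨ S.ρ 0 = S.ρ 1) :
    ∃ e : ℝ, ∀ u, Tendsto (S.limitError u) (𝓝[>] 0) (𝓝 e) := by
  by_cases hdet : S.X.det = 0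
  · have hρ' : S.ρ 0 = S.ρ 1 := hX.resolve_left (by simp [hdet])
    refine ⟨1 - S.ρ 0 / (S.ρ 0 + S.ρ 1),
      Fin.forall_fin_two.2 ⟨S.tendsto_limitError_of_det_eq_zero hρ hdet 0, ?_⟩⟩
    simpa only [hρ'] using S.tendsto_limitError_of_det_eq_zero hρ hdet 1
  · exact ⟨0, S.tendsto_limitError_of_det_ne_zero hdet⟩

end LimitError

section LargeArrayLimit

variable {S} {Ω : Type*} [MeasurableSpace Ω] {μ : Measure Ω} [IsProbabilityMeasure μ] {σ2 : ℝ}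

theorem integrable_and_tendsto_sqError_div (hL0 : 0 < L) (hL : L ≤ N) (hP : S.P.Nonempty)
    (hD : 0 < S.D) (hΔ : 0 < S.Δ) (hρ : ∀ u, 0 < S.ρ u) (hσ : 0 < σ2) {d : ℕ → ℕ}
    (hd : Tendsto d atTop atTop) (hd5 : ∀ n, 5 ≤ d n) {h : ∀ n, Fin 2 → Fin (d n) × Fin L → Ω → ℂ}
    {w : ∀ n, Fin (d n) × Fin 2 × Fin N → Ω → ℂ} (hm : ∀ n, S.IsModel μ (d n) σ2 (h n) (w n))
    (u : Fin 2) :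
    (∀ n, Integrable (fun ω =>
      S.sqError hL u (fun v y => h n v y ω) (fun y => w n y ω) / ((d n : ℝ) * S.s)) μ) ∧
    Tendsto (fun n => ∫ ω,
      S.sqError hL u (fun v y => h n v y ω) (fun y => w n y ω) / ((d n : ℝ) * S.s) ∂μ) atTop
      (𝓝 (S.limitError u σ2)) := by
  have hd0 (n : ℕ) : 0 < d n := by linarith [hd5 n]
  have hbound : invDetBound (Fin 2) σ2 ^ (1 / 2 : ℝ) ≠ ∞ :=
    ENNReal.rpow_ne_top_of_nonneg (by norm_num) (invDetBound_ne_top hσ)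
  simp only [S.sqError_div_eq_lmmseError hL0 hL hP hΔ (hd0 _), ← S.lmmseError_limitGram hρ hσ]
  refine integrable_and_tendsto_integral_lmmseError
    (b := (invDetBound (Fin 2) σ2 ^ (1 / 2 : ℝ)).toNNReal) _ _
    (tendstoInMeanSquare_gram hL0 hL hP hD hΔ hd hd0 hm)
    (fun n ω => S.posSemidef_gram hL _ _) (fun n => ?_) ?_
  · simp only [mixing_mul_gram_mul_conjTranspose, ENNReal.coe_toNNReal hbound]
    exact (hm n).eLpNorm_inv_det_C_le hL hσ
      ((hd5 n).trans (Nat.le_mul_of_pos_right _ hP.card_pos))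
  · rw [mixing_mul_limitGram_mul_conjTranspose]
    exact S.det_limitCov_ne_zero hρ hσ

theorem integrable_and_tendsto_nmse (hL0 : 0 < L) (hL : L ≤ N) (hP : S.P.Nonempty)
    (hD : 0 < S.D) (hΔ : 0 < S.Δ) (hρ : ∀ u, 0 < S.ρ u) (hσ : 0 < σ2)
    {h : ∀ NT, Fin 2 → Fin NT × Fin L → Ω → ℂ} {w : ∀ NT, Fin NT × Fin 2 × Fin N → Ω → ℂ}
    (hm : ∀ NT, S.IsModel μ NT σ2 (h NT) (w NT)) (u : Fin 2) :
    (∀ᶠ NT in atTop, Integrable (fun ω =>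
      S.sqError hL u (fun v y => h NT v y ω) (fun y => w NT y ω)) μ) ∧
    Tendsto (fun NT => S.nmse hL μ u (h NT) (w NT)) atTop (𝓝 (S.limitError u σ2)) := by
  obtain ⟨hint, hlim⟩ := integrable_and_tendsto_sqError_div hL0 hL hP hD hΔ hρ hσ
    (tendsto_add_atTop_nat 5) (fun n => Nat.le_add_left 5 n) (fun n => hm (n + 5)) u
  constructor
  · filter_upwards [eventually_ge_atTop 5] with NT hNT
    obtain ⟨n, rfl⟩ := Nat.exists_eq_add_of_le' hNT
    have hs : (0 : ℝ) < S.s := by exact_mod_cast hP.card_pos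
    have hne : ((n + 5 : ℕ) : ℝ) * S.s ≠ 0 := by positivity
    simpa only [div_mul_cancel₀ _ hne] using (hint n).mul_const (((n + 5 : ℕ) : ℝ) * S.s)
  · refine (tendsto_add_atTop_iff_nat 5).1 (hlim.congr fun n => ?_)
    rw [integral_div, nmse]

end LargeArrayLimit

end Setup

end PilotTraining

theorem proposition3 {N L : ℕ} (S : PilotTraining.Setup N L) (hL0 : 0 < L) (hL : L ≤ N)
    (hP : S.P.Nonempty) (hD : 0 < S.D) (hΔ : 0 < S.Δ) (hρ : ∀ u, 0 < S.ρ u)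
    (hX : IsUnit S.X.det ∨ S.ρ 0 = S.ρ 1)
    {Ω : Type*} [MeasurableSpace Ω] (μ : Measure Ω) [IsProbabilityMeasure μ]
    (h : (σ2 : ℝ) → (NT : ℕ) → Fin 2 → Fin NT × Fin L → Ω → ℂ)
    (w : (σ2 : ℝ) → (NT : ℕ) → Fin NT × Fin 2 × Fin N → Ω → ℂ)
    (hmodel : ∀ σ2 : ℝ, 0 < σ2 → ∀ NT : ℕ, S.IsModel μ NT σ2 (h σ2 NT) (w σ2 NT)) :
    (∀ σ2 : ℝ, 0 < σ2 → ∀ u : Fin 2, ∀ᶠ NT : ℕ in atTop,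
      Integrable (fun ω => S.sqError hL u (fun v x => h σ2 NT v x ω) (fun x => w σ2 NT x ω)) μ) ∧
    ∃ εB εA : ℝ → ℝ,
      (∀ σ2 : ℝ, 0 < σ2 →
        Tendsto (fun NT : ℕ => S.nmse hL μ 0 (h σ2 NT) (w σ2 NT)) atTop (𝓝 (εB σ2)) ∧
        Tendsto (fun NT : ℕ => S.nmse hL μ 1 (h σ2 NT) (w σ2 NT)) atTop (𝓝 (εA σ2))) ∧
      ∃ e : ℝ, Tendsto εB (𝓝[>] 0) (𝓝 e) ∧ Tendsto εA (𝓝[>] 0) (𝓝 e) := by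
  have hlim (σ2 : ℝ) (hσ : 0 < σ2) (u : Fin 2) :=
    PilotTraining.Setup.integrable_and_tendsto_nmse hL0 hL hP hD hΔ hρ hσ (hmodel σ2 hσ) u
  obtain ⟨e, he⟩ := S.exists_tendsto_limitError hρ hX
  exact ⟨fun σ2 hσ u => (hlim σ2 hσ u).1, S.limitError 0, S.limitError 1,
    fun σ2 hσ => ⟨(hlim σ2 hσ 0).2, (hlim σ2 hσ 1).2⟩, e, he 0, he 1⟩
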